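/- Let $n\ge 3$, $\beta:=2/(n-2)$, $C>0$, $T>0$ and $R\in\mathbb R$. Let $H^1(\mathbb R^n)$ carry the norm $\|v\|_{H^1}=(\|v\|_{L^2}^2+\|\nabla v\|_{L^2}^2)^{1/2}$, and let $A$ be the operator in $L^2(\mathbb R^n)$ with domain $D(A)=H^2(\mathbb R^n)$ and $Av=-\Delta v$ in the distributional sense. All functions are real-valued. Let $G_j$ ($j=1,2,3,\dots$) and $G$ be continuous functions $\mathbb R^n\times\mathbb R\to\mathbb R$, continuously differentiable in the second variable for each fixed $x\in\mathbb R^n$, such that each $F\in\{G,G_1,G_2,\dots\}$ satisfies, with the same constant $C$, $$F(\cdot,0)\in L^2(\mathbb R^n),\qquad |F'_u(x,u)|\le C(1+|u|^\beta)\quad\text{for all }(x,u)\in\mathbb R^n\times\mathbb R. $$ Assume that $G_j(x,u)\to G(x,u)$ for all $(x,u)\in\mathbb R^n\times\mathbb R$ and that $G_j(\cdot,0)\to G(\cdot,0)$ in $L^2(\mathbb R^n)$ as $j\to\infty$. For such $F$, a solution on $[0,T]$ of $u_t-\Delta u=F(x,u)$ is a map $u:[0,T]\to H^1(\mathbb R^n)$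 that is continuous into $H^1(\mathbb R^n)$ and such that for every $t\in(0,T)$ it is differentiable at $t$ as a map into $L^2(\mathbb R^n)$, $u(t)\in D(A)$, and $\dot u(t)+Au(t)=F(\cdot,u(t)(\cdot))$ in $L^2(\mathbb R^n)$. Let $u_j$ be a solution on $[0,T]$ with $F=G_j$, for each $j$, and let $u$ be a solution on $[0,T]$ with $F=G$. Assume that $\|u(t)\|_{H^1}\le R$ and $\|u_j(t)\|_{H^1}\le R$ for all $t\in[0,T]$ and all $j$. 1. If $u_j(0)\to u(0)$ in $L^2(\mathbb R^n)$, then for every $0<\delta<T$, $u_j(t)\to u(t)$ in $H^1(\mathbb R^n)$ as $j\to\infty$, uniformly for $t\in[\delta,T]$. 2. If $u_j(0)\to u(0)$ in $H^1(\mathbb R^n)$, then $u_j(t)\to u(t)$ in $H^1(\mathbb R^n)$ as $j\to\infty$, uniformly for $t\in[0,T]$. -/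

import Mathlib

open MeasureTheory Set Filter Topology
open scoped ENNReal ContDiff Laplacian

noncomputable section

namespace HeatRn

/-- The Euclidean space `ℝⁿ`. -/
abbrev Rn (n : ℕ) := EuclideanSpace ℝ (Fin n)

/-- The real space `L²(ℝⁿ)`. -/
abbrev L2 (n : ℕ) := Lp ℝ 2 (volume : Measure (Rn n))

/-- The space `L²(ℝⁿ; ℝⁿ)` of square integrable vector fields. -/
abbrev L2Vec (n : ℕ) := Lp (Rn n) 2 (volume : Measure (Rn n))

/-- Real test functions of class `C_c^∞` on `ℝⁿ`. -/
def IsTest {n : ℕ} (φ : Rn n → ℝ) : Prop := ContDiff ℝ ∞ φ ∧ HasCompactSupport φ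

/-- The classical partial derivative `∂φ/∂xᵢ`. -/
def partialD {n : ℕ} (i : Fin n) (φ : Rn n → ℝ) (x : Rn n) : ℝ :=
  fderiv ℝ φ x (EuclideanSpace.single i 1)

/-- `g` is the weak (distributional) gradient of `v`. -/
def HasWeakGradient {n : ℕ} (v : Rn n → ℝ) (g : Rn n → Rn n) : Prop :=
  ∀ φ : Rn n → ℝ, IsTest φ → ∀ i : Fin n,
    ∫ x, v x * partialD i φ x = - ∫ x, g x i * φ x

theorem IsTest.memLp {n : ℕ} {φ : Rn n → ℝ} (h : IsTest φ) :
    MemLp φ 2 (volume : Measure (Rn n)) :=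
  h.1.continuous.memLp_of_hasCompactSupport h.2

theorem IsTest.memLp_partialD {n : ℕ} {φ : Rn n → ℝ} (h : IsTest φ) (i : Fin n) :
    MemLp (partialD i φ) 2 (volume : Measure (Rn n)) := by
  have hc : Continuous (partialD i φ) :=
    (h.1.continuous_fderiv (by simp)).clm_apply continuous_const
  refine hc.memLp_of_hasCompactSupport ?_
  exact (h.2.fderiv (𝕜 := ℝ)).comp_left (g := fun L : Rn n →L[ℝ] ℝ => L (EuclideanSpace.single i 1))
    (by simp)

theorem memLp_coord {n : ℕ} (g : L2Vec n) (i : Fin n) :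
    MemLp (fun x => g x i) 2 (volume : Measure (Rn n)) :=
  (EuclideanSpace.proj (𝕜 := ℝ) i).comp_memLp' (Lp.memLp g)

/-- The Sobolev space `H¹(ℝⁿ)`, realized as the space of all pairs `(v, ∇v)` of a function
`v ∈ L²` and its weak gradient `∇v ∈ L²`, inside the Hilbert sum `L²(ℝⁿ) ⊕ L²(ℝⁿ; ℝⁿ)`. The norm
which it inherits is `‖v‖_{H¹} = (‖v‖²_{L²} + ‖∇v‖²_{L²})^{1/2}`. -/
def H1 (n : ℕ) : Submodule ℝ (WithLp 2 (L2 n × L2Vec n)) where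
  carrier := {p | HasWeakGradient p.fst p.snd}
  zero_mem' := by
    intro φ hφ i
    have h1 : ∫ x, (0 : L2 n) x * partialD i φ x = 0 := by
      rw [← integral_zero (Rn n) ℝ (μ := volume)]
      refine integral_congr_ae ?_
      filter_upwards [Lp.coeFn_zero ℝ 2 (volume : Measure (Rn n))] with x hx
      simp
    have h2 : ∫ x, (0 : L2Vec n) x i * φ x = 0 := by
      rw [← integral_zero (Rn n) ℝ (μ := volume)]
      refine integral_congr_ae ?_
      filter_upwards [Lp.coeFn_zero (Rn n) 2 (volume : Measure (Rn n))] with x hx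
      simp
    exact h1.trans (neg_eq_zero.mpr h2).symm
  add_mem' := by
    intro p q hp hq φ hφ i
    have h1 : ∫ x, (p.fst + q.fst : L2 n) x * partialD i φ x
        = (∫ x, p.fst x * partialD i φ x) + ∫ x, q.fst x * partialD i φ x := by
      rw [← integral_add (f := fun x => p.fst x * partialD i φ x)
        (g := fun x => q.fst x * partialD i φ x)
        ((Lp.memLp p.fst).integrable_mul (hφ.memLp_partialD i))
        ((Lp.memLp q.fst).integrable_mul (hφ.memLp_partialD i))]
      refine integral_congr_ae ?_
      filter_upwards [Lp.coeFn_add p.fst q.fst] with x hx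
      rw [hx, Pi.add_apply]; simp [add_mul]
    have h2 : ∫ x, (p.snd + q.snd : L2Vec n) x i * φ x
        = (∫ x, p.snd x i * φ x) + ∫ x, q.snd x i * φ x := by
      rw [← integral_add (f := fun x => p.snd x i * φ x) (g := fun x => q.snd x i * φ x)
        ((memLp_coord p.snd i).integrable_mul hφ.memLp)
        ((memLp_coord q.snd i).integrable_mul hφ.memLp)]
      refine integral_congr_ae ?_
      filter_upwards [Lp.coeFn_add p.snd q.snd] with x hx
      rw [hx, Pi.add_apply]; simp [add_mul]
    calc _ = ∫ x, (p.fst + q.fst : L2 n) x * partialD i φ x := rfl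
      _ = - ∫ x, (p.snd + q.snd : L2Vec n) x i * φ x := by
        rw [h1, h2, hp φ hφ i, hq φ hφ i]; ring
      _ = _ := rfl
  smul_mem' := by
    intro c p hp φ hφ i
    have h1 : ∫ x, (c • p.fst : L2 n) x * partialD i φ x
        = c * ∫ x, p.fst x * partialD i φ x := by
      rw [← integral_const_mul]
      refine integral_congr_ae ?_
      filter_upwards [Lp.coeFn_smul c p.fst] with x hx
      simp [hx, mul_assoc]
    have h2 : ∫ x, (c • p.snd : L2Vec n) x i * φ x = c * ∫ x, p.snd x i * φ x := by
      rw [← integral_const_mul]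
      refine integral_congr_ae ?_
      filter_upwards [Lp.coeFn_smul c p.snd] with x hx
      simp [hx, mul_assoc]
    calc _ = ∫ x, (c • p.fst : L2 n) x * partialD i φ x := rfl
      _ = - ∫ x, (c • p.snd : L2Vec n) x i * φ x := by
        rw [h1, h2, hp φ hφ i]; ring
      _ = _ := rfl

/-- The inclusion `H¹(ℝⁿ) ⊂ L²(ℝⁿ)`. -/
def toL2 {n : ℕ} (v : H1 n) : L2 n := (v : WithLp 2 (L2 n × L2Vec n)).fst

/-- The weak gradient of an element of `H¹(ℝⁿ)`. -/
def grad {n : ℕ} (v : H1 n) : L2Vec n := (v : WithLp 2 (L2 n × L2Vec n)).snd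

/-- `v ∈ H²(ℝⁿ)`: each first order weak derivative of `v` belongs to `H¹(ℝⁿ)`. -/
def MemH2 {n : ℕ} (v : H1 n) : Prop :=
  ∀ i : Fin n, ∃ w : H1 n, ∀ᵐ x, toL2 w x = grad v x i

/-- The graph of the operator `A` in `L²(ℝⁿ)` with domain `H²(ℝⁿ)`, where `A v = -Δ v` in the
distributional sense: `v ∈ D(A)` and `A v = a`. -/
def IsNegLaplacian {n : ℕ} (v : H1 n) (a : L2 n) : Prop :=
  MemH2 v ∧ ∀ φ : Rn n → ℝ, IsTest φ → ∫ x, a x * φ x = - ∫ x, toL2 v x * Δ φ x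

/-- The regularity of the nonlinearity: `F` is continuous and `F(x, ·)` is continuously
differentiable for every `x`. -/
def IsNonlinearity {n : ℕ} (F : Rn n → ℝ → ℝ) : Prop :=
  Continuous (fun p : Rn n × ℝ => F p.1 p.2) ∧ ∀ x, ContDiff ℝ 1 (F x)

/-- The growth condition with constant `C`: `F(·, 0) ∈ L²(ℝⁿ)` and `|F'_u(x, u)| ≤ C (1 + |u|^β)`
for all `(x, u)`, where `β = 2 / (n - 2)`. -/
def GrowthCondition {n : ℕ} (C : ℝ) (F : Rn n → ℝ → ℝ) : Prop :=
  MemLp (fun x => F x 0) 2 (volume : Measure (Rn n)) ∧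
    ∀ (x : Rn n) (s : ℝ), |deriv (F x) s| ≤ C * (1 + |s| ^ ((2 : ℝ) / ((n : ℝ) - 2)))

/-- `u : [0, T] → H¹(ℝⁿ)` is a solution of `u_t - Δ u = F(x, u)`, in the abstract form
`u̇ + A u = F̂(u)`: it is continuous on `[0, T]` with values in `H¹`, and, for `0 < t < T`, it is
differentiable at `t` as a map to `L²`, `u(t) ∈ D(A)`, and the equation holds in `L²`.
The values of `u` outside `[0, T]` play no role. -/
def IsSolution {n : ℕ} (F : Rn n → ℝ → ℝ) (T : ℝ) (u : ℝ → H1 n) : Prop :=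
  ContinuousOn u (Icc 0 T) ∧
    ∀ t ∈ Ioo 0 T, ∃ d a : L2 n,
      HasDerivAt (fun s => toL2 (u s)) d t ∧ IsNegLaplacian (u t) a ∧
        ∀ᵐ x, d x + a x = F x (toL2 (u t) x)

end HeatRn

end

/-! The difference `w = u_j - u` solves `w' + A w = h` with `‖h‖ ≤ L ‖w‖_{H¹} + ε` in `L²`. Indeed
`h = (G_j(u_j) - G_j(u)) + (G_j(u) - G(u))`. For the first bracket, `β` is the critical exponent: by
Hölder and Sobolev, every Nemytskii operator with growth constant `C` is Lipschitz from the `R`-ball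
of `H¹` to `L²` with one common constant `L` (`exists_lipschitz_nemytskii`). For the second,
dominated convergence gives `G_j(v) → G(v)` in `L²` for each fixed `v`, and the common Lipschitz
constant makes this uniform on the compact set `u([0,T])` (`eventually_nemytskii_le`). Only `u` has
to lie in a compact set; the `u_j` are merely bounded.

Stability then follows from the energy `E(t) = M ‖w‖² + (p + q t) ‖∇w‖²` (`energy_le`). For `M`
large the dissipation absorbs the gradient terms, and Grönwall bounds `E(t)` by a constant times
`E(0) + ε²`. The weight `t` removes the initial gradient from `E(0)`, which is the smoothing effect
behind the first claim; the weight `1` gives the second.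

Since `w` is differentiable only into `L²`, `‖∇w‖²` need not be differentiable. Convexity of the
Dirichlet form replaces its derivative by a one-sided bound, enough for a Grönwall inequality with
left Dini derivatives (`le_exp_mul_of_left_dini`). The integration by parts `(A v, z) = (∇v, ∇z)`
and the Sobolev inequality both rest on the density of test functions in `H¹` (`denseRange_testH1`).
-/

noncomputable section

namespace HeatRn

/-! ### Convergence and averaging in `L²`. -/

section L2Tools

theorem eLpNorm_two_sq {α E : Type*} [MeasurableSpace α] [NormedAddCommGroup E] (μ : Measure α)
    (f : α → E) : eLpNorm f 2 μ ^ 2 = ∫⁻ x, ‖f x‖ₑ ^ 2 ∂μ := by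
  rw [eLpNorm_eq_lintegral_rpow_enorm_toReal (by simp) (by simp)]
  rw [← ENNReal.rpow_natCast, ← ENNReal.rpow_mul]
  simp

/-- Dominated convergence in `L²`. -/
theorem tendsto_eLpNorm_two_of_dominated {α : Type*} [MeasurableSpace α] {μ : Measure α}
    {F : ℕ → α → ℝ} {b : α → ℝ}
    (hb : MemLp b 2 μ) (hF : ∀ j, AEStronglyMeasurable (F j) μ)
    (hle : ∀ j, ∀ᵐ x ∂μ, ‖F j x‖ ≤ b x)
    (hlim : ∀ᵐ x ∂μ, Tendsto (fun j => F j x) atTop (𝓝 0)) :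
    Tendsto (fun j => eLpNorm (F j) 2 μ) atTop (𝓝 0) := by
  have h2 : Tendsto (fun j => ∫⁻ x, ‖F j x‖ₑ ^ 2 ∂μ) atTop (𝓝 (∫⁻ _, 0 ∂μ)) := by
    refine tendsto_lintegral_of_dominated_convergence' (fun x => ‖b x‖ₑ ^ 2)
      (fun j => (hF j).enorm.pow_const 2) ?_ ?_ ?_
    · intro j
      filter_upwards [hle j] with x hx
      gcongr
      exact enorm_le_iff_norm_le.2 (hx.trans (le_abs_self _))
    · rw [← eLpNorm_two_sq]
      exact ENNReal.pow_ne_top hb.eLpNorm_ne_top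
    · filter_upwards [hlim] with x hx
      have := (ENNReal.continuous_pow 2).tendsto _ |>.comp hx.enorm
      simpa [Function.comp_def] using this
  simp only [lintegral_zero, ← eLpNorm_two_sq] at h2
  have h3 := ((ENNReal.continuous_rpow_const (y := (1/2 : ℝ))).tendsto _).comp h2
  refine (h3.congr fun j => ?_).trans (by simp)
  simp only [Function.comp_def]
  rw [← ENNReal.rpow_natCast, ← ENNReal.rpow_mul]
  simp

/-- Jensen's inequality for the square and a probability density. -/
theorem lintegral_mul_sq_le {α : Type*} [MeasurableSpace α] {μ : Measure α} {p a : α → ℝ≥0∞}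
    (hp : Measurable p) (ha : AEMeasurable a μ) (h1 : ∫⁻ t, p t ∂μ = 1) :
    (∫⁻ t, p t * a t ∂μ) ^ 2 ≤ ∫⁻ t, p t * a t ^ 2 ∂μ := by
  -- Cauchy–Schwarz for the splitting `p a = p^{1/2} · (p^{1/2} a)`.
  have hm : AEMeasurable (fun t => p t ^ (1/2 : ℝ)) μ := (hp.pow_const _).aemeasurable
  have h := ENNReal.lintegral_mul_le_Lp_mul_Lq μ Real.HolderConjugate.two_two hm (hm.mul ha)
  have e (t : α) : p t ^ (1/2 : ℝ) * p t ^ (1/2 : ℝ) = p t := by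
    rw [← ENNReal.rpow_add_of_nonneg _ _ (by norm_num) (by norm_num)]; norm_num
  have e2 (t : α) : (p t ^ (1/2 : ℝ)) ^ (2 : ℝ) = p t := by
    rw [← ENNReal.rpow_mul]; norm_num
  simp only [Pi.mul_apply, ← mul_assoc, e, e2, h1, ENNReal.one_rpow, one_mul,
    ENNReal.mul_rpow_of_nonneg _ _ (zero_le_two (α := ℝ))] at h
  calc _ ≤ ((∫⁻ t, p t * a t ^ (2 : ℝ) ∂μ) ^ (1/2 : ℝ)) ^ 2 := by gcongr
    _ = _ := by
      rw [← ENNReal.rpow_natCast, ← ENNReal.rpow_mul]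
      simp

end L2Tools

/-! ### Translations and mollification in `L²(ℝⁿ)`. -/

variable {n : ℕ}

/-- Translations are continuous in `L²`. -/
theorem tendsto_eLpNorm_translate_sub {f : Rn n → ℝ} (hf : MemLp f 2 volume) :
    Tendsto (fun t : Rn n => eLpNorm (fun x => f (x - t) - f x) 2 volume) (𝓝 0) (𝓝 0) := by
  -- Currying turns the translations `x ↦ x - t` into a continuous family of measure preserving
  -- maps.
  let g : C(Rn n × Rn n, Rn n) := ⟨fun a => a.2 - a.1, by fun_prop⟩
  have hg : ∀ t, MeasurePreserving (g.curry t) (volume : Measure (Rn n)) volume := fun t =>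
    measurePreserving_sub_right volume t
  have h := Filter.Tendsto.compMeasurePreservingLp (l := 𝓝 (0 : Rn n)) (f := fun _ => hf.toLp f)
    (f₀ := hf.toLp f) (p := 2) tendsto_const_nhds (g.curry.continuous.tendsto 0) hg (hg 0) (by simp)
  rw [Lp.tendsto_Lp_iff_tendsto_eLpNorm'] at h
  refine h.congr fun t => eLpNorm_congr_ae ?_
  rw [Lp.toLp_compMeasurePreserving, Lp.toLp_compMeasurePreserving]
  refine (MemLp.coeFn_toLp _).sub (MemLp.coeFn_toLp _) |>.trans ?_
  refine Eventually.of_forall fun x => ?_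
  simp [g]

/-- The mollification of `f` by a normalized bump function. -/
def moll (φ : ContDiffBump (0 : Rn n)) (f : Rn n → ℝ) (x : Rn n) : ℝ :=
  ∫ t, φ.normed volume t * f (x - t)

open scoped Convolution in
theorem moll_eq_convolution (φ : ContDiffBump (0 : Rn n)) (f : Rn n → ℝ) :
    moll φ f = (φ.normed volume ⋆[ContinuousLinearMap.lsmul ℝ ℝ, volume] f : Rn n → ℝ) := by
  ext x
  simp [moll, convolution_def]

theorem contDiff_moll (φ : ContDiffBump (0 : Rn n)) {f : Rn n → ℝ} (hf : MemLp f 2 volume) :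
    ContDiff ℝ ∞ (moll φ f) := by
  rw [moll_eq_convolution]
  exact φ.hasCompactSupport_normed.contDiff_convolution_left (n := ⊤) _ φ.contDiff_normed
    (hf.locallyIntegrable (by norm_num))

theorem moll_sub_self (φ : ContDiffBump (0 : Rn n)) {f : Rn n → ℝ} (hf : MemLp f 2 volume)
    (x : Rn n) : moll φ f x - f x = ∫ t, φ.normed volume t * (f (x - t) - f x) := by
  have h1 : Integrable (fun t => φ.normed volume t * f (x - t)) := by
    have hφ : MemLp (φ.normed (volume : Measure (Rn n))) 2 volume :=
      φ.continuous_normed.memLp_of_hasCompactSupport φ.hasCompactSupport_normed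
    exact hφ.integrable_mul (hf.comp_measurePreserving (Measure.measurePreserving_sub_left volume x))
  simp_rw [mul_sub]
  rw [integral_sub h1 (φ.integrable_normed.mul_const _), integral_mul_const, φ.integral_normed,
    one_mul]
  rfl

theorem lintegral_normed (φ : ContDiffBump (0 : Rn n)) :
    ∫⁻ t, ‖φ.normed volume t‖ₑ = 1 := by
  have : ∀ t, ‖φ.normed (volume : Measure (Rn n)) t‖ₑ = ENNReal.ofReal (φ.normed volume t) := fun t =>
    Real.enorm_of_nonneg (φ.nonneg_normed t)
  simp_rw [this]
  rw [← ofReal_integral_eq_lintegral_ofReal φ.integrable_normed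
    (Eventually.of_forall φ.nonneg_normed), φ.integral_normed, ENNReal.ofReal_one]

/-- The mollification error is an average of translation errors over the support of the bump, so
Jensen and Tonelli bound it by the worst translation error there. -/
theorem eLpNorm_moll_sub_le (φ : ContDiffBump (0 : Rn n)) {f : Rn n → ℝ} (hf : MemLp f 2 volume)
    {η : ℝ≥0∞} (h : ∀ t, ‖t‖ ≤ φ.rOut → eLpNorm (fun x => f (x - t) - f x) 2 volume ≤ η) :
    eLpNorm (fun x => moll φ f x - f x) 2 volume ≤ η := by
  have hm : AEMeasurable (fun p : Rn n × Rn n => f (p.1 - p.2) - f p.1)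
      ((volume : Measure (Rn n)).prod volume) := by
    refine AEMeasurable.sub ?_ ?_
    · exact hf.1.aemeasurable.comp_quasiMeasurePreserving (quasiMeasurePreserving_sub volume volume)
    · exact hf.1.aemeasurable.comp_fst
  have hφm : Measurable fun t => ‖φ.normed (volume : Measure (Rn n)) t‖ₑ :=
    φ.continuous_normed.measurable.enorm
  rw [← ENNReal.pow_le_pow_left_iff (n := 2) (by norm_num), eLpNorm_two_sq]
  calc ∫⁻ x, ‖moll φ f x - f x‖ₑ ^ 2
      ≤ ∫⁻ x, ∫⁻ t, ‖φ.normed volume t‖ₑ * ‖f (x - t) - f x‖ₑ ^ 2 := by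
        refine lintegral_mono fun x => ?_
        rw [moll_sub_self φ hf]
        refine le_trans ?_ (lintegral_mul_sq_le hφm ?_ (lintegral_normed φ))
        · gcongr
          refine (enorm_integral_le_lintegral_enorm _).trans_eq ?_
          simp [enorm_mul]
        · exact ((hf.1.comp_measurePreserving
            (Measure.measurePreserving_sub_left volume x)).aemeasurable.sub_const _).enorm
    _ = ∫⁻ t, ∫⁻ x, ‖φ.normed volume t‖ₑ * ‖f (x - t) - f x‖ₑ ^ 2 := by
        refine lintegral_lintegral_swap ?_
        exact (hφm.comp measurable_snd).aemeasurable.mul (hm.enorm.pow_const 2)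
    _ ≤ ∫⁻ t, ‖φ.normed volume t‖ₑ * η ^ 2 := by
        refine lintegral_mono fun t => ?_
        rw [lintegral_const_mul' _ _ enorm_ne_top]
        by_cases ht : ‖t‖ ≤ φ.rOut
        · gcongr
          rw [← eLpNorm_two_sq]
          gcongr
          exact h t ht
        · have : φ.normed (volume : Measure (Rn n)) t = 0 := by
            by_contra h0
            have : t ∈ Function.support (φ.normed (volume : Measure (Rn n))) := h0
            rw [φ.support_normed_eq] at this
            exact ht (by simpa using (mem_ball_zero_iff.1 this).le)
          simp [this]
    _ = η ^ 2 := by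
        rw [lintegral_mul_const _ hφm, lintegral_normed, one_mul]

/-- The mollifiers `φₖ` with support of radius `2 / (k + 1)`. -/
def mollifier (n k : ℕ) : ContDiffBump (0 : Rn n) where
  rIn := 1 / (k + 1)
  rOut := 2 / (k + 1)
  rIn_pos := by positivity
  rIn_lt_rOut := by gcongr; norm_num

theorem tendsto_eLpNorm_moll_sub {f : Rn n → ℝ} (hf : MemLp f 2 volume) :
    Tendsto (fun k => eLpNorm (fun x => moll (mollifier n k) f x - f x) 2 volume) atTop (𝓝 0) := by
  rw [ENNReal.tendsto_nhds_zero]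
  intro η hη
  have h := ENNReal.tendsto_nhds_zero.1 (tendsto_eLpNorm_translate_sub hf) η hη
  obtain ⟨δ, hδ, hball⟩ := Metric.eventually_nhds_iff_ball.1 h
  have hr : Tendsto (fun k : ℕ => 2 / ((k : ℝ) + 1)) atTop (𝓝 0) := by
    have := (tendsto_one_div_add_atTop_nhds_zero_nat (𝕜 := ℝ)).const_mul 2
    simpa [div_eq_mul_inv] using this
  filter_upwards [hr.eventually (gt_mem_nhds hδ)] with k hk
  exact eLpNorm_moll_sub_le _ hf fun t ht => hball t (by simpa using ht.trans_lt hk)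

/-! ### The `H¹` norm and its two components. -/

section H1Basic

theorem toL2_sub (v w : H1 n) : toL2 (v - w) = toL2 v - toL2 w := rfl

theorem grad_sub (v w : H1 n) : grad (v - w) = grad v - grad w := rfl

theorem H1.norm_sq (v : H1 n) : ‖v‖ ^ 2 = ‖toL2 v‖ ^ 2 + ‖grad v‖ ^ 2 :=
  WithLp.prod_norm_sq_eq_of_L2 (v : WithLp 2 (L2 n × L2Vec n))

theorem norm_toL2_le (v : H1 n) : ‖toL2 v‖ ≤ ‖v‖ := by
  refine le_of_sq_le_sq ?_ (norm_nonneg v)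
  rw [H1.norm_sq]; nlinarith [sq_nonneg ‖grad v‖]

theorem norm_grad_le (v : H1 n) : ‖grad v‖ ≤ ‖v‖ := by
  refine le_of_sq_le_sq ?_ (norm_nonneg v)
  rw [H1.norm_sq]; nlinarith [sq_nonneg ‖toL2 v‖]

theorem H1.norm_le_add (v : H1 n) : ‖v‖ ≤ ‖toL2 v‖ + ‖grad v‖ := by
  refine le_of_sq_le_sq ?_ (by positivity)
  rw [H1.norm_sq]
  nlinarith [norm_nonneg (toL2 v), norm_nonneg (grad v)]

theorem continuous_toL2 : Continuous (toL2 : H1 n → L2 n) :=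
  (LipschitzWith.of_dist_le_mul (K := 1) fun v w => by
    simpa [dist_eq_norm, toL2_sub] using norm_toL2_le (v - w)).continuous

theorem continuous_grad : Continuous (grad : H1 n → L2Vec n) :=
  (LipschitzWith.of_dist_le_mul (K := 1) fun v w => by
    simpa [dist_eq_norm, grad_sub] using norm_grad_le (v - w)).continuous

end H1Basic

/-! ### Test functions as elements of `H¹`. -/

section TestFunctions

/-- The classical gradient. -/
def gradVec (φ : Rn n → ℝ) (x : Rn n) : Rn n := WithLp.toLp 2 fun i => partialD i φ x

theorem IsTest.continuous_partialD {φ : Rn n → ℝ} (h : IsTest φ) (i : Fin n) :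
    Continuous (partialD i φ) :=
  (h.1.continuous_fderiv (by simp)).clm_apply continuous_const

theorem IsTest.memLp_gradVec {φ : Rn n → ℝ} (h : IsTest φ) : MemLp (gradVec φ) 2 volume := by
  have hc : Continuous (gradVec φ) :=
    (PiLp.continuous_toLp 2 _).comp (continuous_pi fun i => h.continuous_partialD i)
  refine hc.memLp_of_hasCompactSupport ?_
  refine (h.2.fderiv (𝕜 := ℝ)).comp_left
    (g := fun L : Rn n →L[ℝ] ℝ => WithLp.toLp 2 fun i => L (EuclideanSpace.single i 1)) ?_
  ext i; simp

theorem IsTest.integral_mul_partialD {φ ψ : Rn n → ℝ} (h : IsTest φ) (hψ : IsTest ψ) (i : Fin n) :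
    ∫ x, φ x * partialD i ψ x = - ∫ x, partialD i φ x * ψ x := by
  refine integral_mul_fderiv_eq_neg_fderiv_mul_of_integrable ?_ ?_ ?_ ?_ ?_
  · exact (h.memLp_partialD i).integrable_mul hψ.memLp
  · exact h.memLp.integrable_mul (hψ.memLp_partialD i)
  · exact h.memLp.integrable_mul hψ.memLp
  · exact fun x _ => h.1.differentiable (by simp) x
  · exact fun x _ => hψ.1.differentiable (by simp) x

/-- A test function as an element of `H¹`. -/
def testH1 (φ : Rn n → ℝ) (h : IsTest φ) : H1 n :=
  ⟨WithLp.toLp 2 (h.memLp.toLp φ, h.memLp_gradVec.toLp (gradVec φ)), by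
    intro ψ hψ i
    have h1 : ∫ x, h.memLp.toLp φ x * partialD i ψ x = ∫ x, φ x * partialD i ψ x := by
      refine integral_congr_ae ?_
      filter_upwards [h.memLp.coeFn_toLp] with x hx
      rw [hx]
    have h2 : ∫ x, h.memLp_gradVec.toLp (gradVec φ) x i * ψ x = ∫ x, partialD i φ x * ψ x := by
      refine integral_congr_ae ?_
      filter_upwards [h.memLp_gradVec.coeFn_toLp] with x hx
      rw [hx]; rfl
    exact h1.trans ((h.integral_mul_partialD hψ i).trans (congrArg Neg.neg h2.symm))⟩

theorem toL2_testH1 {φ : Rn n → ℝ} (h : IsTest φ) : toL2 (testH1 φ h) = h.memLp.toLp φ := rfl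

theorem grad_testH1 {φ : Rn n → ℝ} (h : IsTest φ) :
    grad (testH1 φ h) = h.memLp_gradVec.toLp (gradVec φ) := rfl

theorem norm_le_sum_abs (x : Rn n) : ‖x‖ ≤ ∑ i, |x i| := by
  have h := (EuclideanSpace.basisFun (Fin n) ℝ).sum_repr x
  conv_lhs => rw [← h]
  refine (norm_sum_le _ _).trans_eq ?_
  simp [norm_smul]

theorem eLpNorm_le_sum_coord {g : Rn n → Rn n} (hg : AEStronglyMeasurable g volume) :
    eLpNorm g 2 volume ≤ ∑ i, eLpNorm (fun x => g x i) 2 volume := by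
  have hm (i : Fin n) : AEStronglyMeasurable (fun x => g x i) volume :=
    (EuclideanSpace.proj (𝕜 := ℝ) i).continuous.comp_aestronglyMeasurable hg
  calc eLpNorm g 2 volume ≤ eLpNorm (∑ i, fun x => |g x i|) 2 volume := by
        refine eLpNorm_mono_real fun x => ?_
        simpa using norm_le_sum_abs (g x)
    _ ≤ ∑ i, eLpNorm (fun x => |g x i|) 2 volume :=
        eLpNorm_sum_le (fun i _ => (hm i).norm) (by norm_num)
    _ = _ := by
        refine Finset.sum_congr rfl fun i _ => ?_
        exact eLpNorm_norm (fun x => g x i)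

end TestFunctions

/-! ### Cutoff functions on growing balls. -/

section Cutoff

/-- A smooth bump function which equals `1` on the unit ball. -/
def unitBump (n : ℕ) : ContDiffBump (0 : Rn n) where
  rIn := 1
  rOut := 2
  rIn_pos := by norm_num
  rIn_lt_rOut := by norm_num

/-- A cutoff function which equals `1` on the ball of radius `k + 1`. -/
def cutoff (n k : ℕ) (x : Rn n) : ℝ := unitBump n (((k : ℝ) + 1)⁻¹ • x)

theorem isTest_cutoff (n k : ℕ) : IsTest (cutoff n k) := by
  constructor
  · exact (unitBump n).contDiff.comp (contDiff_const_smul _)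
  · exact (unitBump n).hasCompactSupport.comp_homeomorph
      (Homeomorph.smulOfNeZero (((k : ℝ) + 1)⁻¹) (by positivity))

theorem eventually_cutoff_eq_one (x : Rn n) : ∀ᶠ k : ℕ in atTop, cutoff n k x = 1 := by
  obtain ⟨m, hm⟩ := exists_nat_ge ‖x‖
  filter_upwards [eventually_ge_atTop m] with k hk
  refine (unitBump n).one_of_mem_closedBall ?_
  rw [mem_closedBall_zero_iff, norm_smul, norm_inv, Real.norm_of_nonneg (by positivity)]
  have h2 : (m : ℝ) ≤ k := by exact_mod_cast hk
  rw [inv_mul_le_iff₀ (by positivity)]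
  simp only [unitBump]; linarith

theorem abs_cutoff_le_one (k : ℕ) (x : Rn n) : |cutoff n k x| ≤ 1 := by
  rw [cutoff, abs_of_nonneg (unitBump n).nonneg]
  exact (unitBump n).le_one

theorem partialD_cutoff (k : ℕ) (i : Fin n) (x : Rn n) :
    partialD i (cutoff n k) x = ((k : ℝ) + 1)⁻¹ * partialD i (unitBump n) (((k : ℝ) + 1)⁻¹ • x) := by
  have h1 := ((unitBump n).contDiff (n := 1)).differentiable (by simp) (((k : ℝ) + 1)⁻¹ • x)
  have h2 := h1.hasFDerivAt.comp x ((hasFDerivAt_id x).const_smul (((k : ℝ) + 1)⁻¹))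
  have h3 : fderiv ℝ (cutoff n k) x = _ := h2.fderiv
  simp [partialD, h3]

theorem exists_partialD_cutoff_le (n : ℕ) : ∃ c : ℝ, 0 ≤ c ∧ ∀ (k : ℕ) (i : Fin n) (x : Rn n),
    |partialD i (cutoff n k) x| ≤ c / (k + 1) := by
  have hψ : IsTest (unitBump n : Rn n → ℝ) := ⟨(unitBump n).contDiff, (unitBump n).hasCompactSupport⟩
  obtain ⟨c, hc⟩ := (hψ.2.fderiv (𝕜 := ℝ)).exists_bound_of_continuous
    (hψ.1.continuous_fderiv (by simp))
  refine ⟨c, (norm_nonneg _).trans (hc 0), fun k i x => ?_⟩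
  rw [partialD_cutoff, abs_mul, abs_of_nonneg (by positivity), div_eq_inv_mul]
  gcongr
  refine ((fderiv ℝ (unitBump n : Rn n → ℝ) _).le_opNorm _).trans ?_
  simpa using hc _

/-- Multiplying an `L²`-convergent sequence by the cutoff functions does not change its limit. -/
theorem tendsto_eLpNorm_cutoff_mul_sub {F : ℕ → Rn n → ℝ} {f : Rn n → ℝ} (hf : MemLp f 2 volume)
    (hF : ∀ k, AEStronglyMeasurable (F k) volume)
    (h : Tendsto (fun k => eLpNorm (fun x => F k x - f x) 2 volume) atTop (𝓝 0)) :
    Tendsto (fun k => eLpNorm (fun x => cutoff n k x * F k x - f x) 2 volume) atTop (𝓝 0) := by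
  have hc (k : ℕ) : AEStronglyMeasurable (cutoff n k) volume :=
    (isTest_cutoff n k).1.continuous.aestronglyMeasurable
  have h2 : Tendsto (fun k => eLpNorm (fun x => cutoff n k x * f x - f x) 2 volume) atTop (𝓝 0) := by
    refine tendsto_eLpNorm_two_of_dominated (b := fun x => 2 * |f x|) (hf.norm.const_mul 2)
      (fun k => ((hc k).mul hf.1).sub hf.1) (fun k => Eventually.of_forall fun x => ?_)
      (Eventually.of_forall fun x => ?_)
    · have h1 := abs_cutoff_le_one k x
      have h3 : |cutoff n k x * f x| ≤ 1 * |f x| := by rw [abs_mul]; gcongr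
      rw [Real.norm_eq_abs]
      linarith [abs_sub (cutoff n k x * f x) (f x)]
    · refine tendsto_const_nhds.congr' ?_
      filter_upwards [eventually_cutoff_eq_one x] with k hk
      simp [hk]
  refine tendsto_of_tendsto_of_tendsto_of_le_of_le tendsto_const_nhds
    (by simpa using h.add h2) (fun _ => zero_le) fun k => ?_
  calc eLpNorm (fun x => cutoff n k x * F k x - f x) 2 volume
      = eLpNorm ((fun x => cutoff n k x * (F k x - f x)) + fun x => cutoff n k x * f x - f x) 2
          volume := by congr 1; ext x; simp; ring
    _ ≤ eLpNorm (fun x => cutoff n k x * (F k x - f x)) 2 volume + _ :=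
        eLpNorm_add_le ((hc k).mul ((hF k).sub hf.1)) (((hc k).mul hf.1).sub hf.1) (by norm_num)
    _ ≤ _ := by
        gcongr
        refine eLpNorm_mono fun x => ?_
        rw [norm_mul]
        exact mul_le_of_le_one_left (norm_nonneg _) (abs_cutoff_le_one k x)

/-- Controls the product-rule remainder: the cutoff gradient is `O(1/(k+1))`, and `F k` stays
bounded in `L²` because it converges. -/
theorem tendsto_eLpNorm_partialD_cutoff_mul {F : ℕ → Rn n → ℝ} {f : Rn n → ℝ}
    (hf : MemLp f 2 volume) (hF : ∀ k, AEStronglyMeasurable (F k) volume)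
    (h : Tendsto (fun k => eLpNorm (fun x => F k x - f x) 2 volume) atTop (𝓝 0)) (i : Fin n) :
    Tendsto (fun k => eLpNorm (fun x => partialD i (cutoff n k) x * F k x) 2 volume)
      atTop (𝓝 0) := by
  obtain ⟨c, hc0, hc⟩ := exists_partialD_cutoff_le n
  have hk : Tendsto (fun k : ℕ => ENNReal.ofReal (c / (k + 1))) atTop (𝓝 0) := by
    have h1 := (tendsto_one_div_add_atTop_nhds_zero_nat (𝕜 := ℝ)).const_mul c
    have h2 := ENNReal.tendsto_ofReal h1
    simpa [div_eq_mul_inv] using h2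
  have hlim := ENNReal.Tendsto.mul hk (Or.inr (by simpa using hf.eLpNorm_ne_top))
    (h.add_const (eLpNorm f 2 volume)) (Or.inr (by simp))
  refine tendsto_of_tendsto_of_tendsto_of_le_of_le tendsto_const_nhds (by simpa using hlim)
    (fun _ => zero_le) fun k => ?_
  calc eLpNorm (fun x => partialD i (cutoff n k) x * F k x) 2 volume
      ≤ ENNReal.ofReal (c / (k + 1)) * eLpNorm (F k) 2 volume := by
        refine eLpNorm_le_mul_eLpNorm_of_ae_le_mul (Eventually.of_forall fun x => ?_) 2
        rw [norm_mul]
        gcongr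
        exact hc k i x
    _ ≤ _ := by
        gcongr
        calc eLpNorm (F k) 2 volume = eLpNorm ((fun x => F k x - f x) + f) 2 volume := by
              congr 1; ext x; simp
          _ ≤ _ := eLpNorm_add_le ((hF k).sub hf.1) hf.1 (by norm_num)

end Cutoff

/-! ### Density of test functions in `H¹`. -/

section Density

/-- The weak gradient is tested against `y ↦ ρ(x - y)`, where `ρ` is the bump; the sign from the
chain rule cancels the one in `HasWeakGradient`. -/
theorem partialD_moll (φ : ContDiffBump (0 : Rn n)) {v : Rn n → ℝ} {g : Rn n → Rn n}
    (hv : MemLp v 2 volume) (h : HasWeakGradient v g) (i : Fin n) (x : Rn n) :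
    partialD i (moll φ v) x = moll φ (fun y => g y i) x := by
  have hφ : IsTest (φ.normed (volume : Measure (Rn n))) :=
    ⟨φ.contDiff_normed, φ.hasCompactSupport_normed (μ := volume)⟩
  have hloc : LocallyIntegrable v volume := hv.locallyIntegrable (by norm_num)
  have h1 := (φ.hasCompactSupport_normed (μ := volume)).hasFDerivAt_convolution_left
    (ContinuousLinearMap.lsmul ℝ ℝ) (φ.contDiff_normed (n := 1)) hloc x
  rw [← moll_eq_convolution] at h1
  have h2 : partialD i (moll φ v) x = ∫ t, partialD i (φ.normed volume) t * v (x - t) := by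
    have hex := (hφ.2.fderiv (𝕜 := ℝ)).convolutionExists_left
      ((ContinuousLinearMap.lsmul ℝ ℝ).precompL (Rn n)) (hφ.1.continuous_fderiv (by simp)) hloc x
    rw [partialD, h1.fderiv, convolution_def, ContinuousLinearMap.integral_apply hex]
    rfl
  have hψ : IsTest (fun y => φ.normed volume (x - y)) := by
    constructor
    · exact hφ.1.comp (contDiff_const.sub contDiff_id)
    · exact hφ.2.comp_homeomorph (Homeomorph.subLeft x)
  have hd (y : Rn n) : partialD i (fun y => φ.normed volume (x - y)) y
      = - partialD i (φ.normed volume) (x - y) := by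
    have h3 := (hφ.1.differentiable (by simp) (x - y)).hasFDerivAt.comp y
      ((hasFDerivAt_id y).const_sub x)
    have h4 : fderiv ℝ (fun y => φ.normed volume (x - y)) y = _ := h3.fderiv
    simp [partialD, h4]
  have h5 := h _ hψ i
  rw [h2, moll, ← integral_sub_left_eq_self _ volume x, ← integral_sub_left_eq_self
    (fun t => φ.normed volume t * g (x - t) i) volume x]
  simp only [sub_sub_cancel]
  simp only [hd] at h5
  simp only [mul_neg, integral_neg, neg_inj] at h5
  simpa only [mul_comm] using h5

theorem isTest_cutoff_mul_moll (k : ℕ) (φ : ContDiffBump (0 : Rn n)) {v : Rn n → ℝ}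
    (hv : MemLp v 2 volume) : IsTest (fun x => cutoff n k x * moll φ v x) :=
  ⟨(isTest_cutoff n k).1.mul (contDiff_moll φ hv), (isTest_cutoff n k).2.mul_right⟩

theorem partialD_cutoff_mul_moll (k : ℕ) (φ : ContDiffBump (0 : Rn n)) {v : Rn n → ℝ}
    {g : Rn n → Rn n} (hv : MemLp v 2 volume) (h : HasWeakGradient v g) (i : Fin n) (x : Rn n) :
    partialD i (fun x => cutoff n k x * moll φ v x) x
      = cutoff n k x * moll φ (fun y => g y i) x + partialD i (cutoff n k) x * moll φ v x := by
  have h1 := ((isTest_cutoff n k).1.differentiable (by simp) x).hasFDerivAt.mul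
    ((contDiff_moll φ hv).differentiable (by simp) x).hasFDerivAt
  have h2 : fderiv ℝ (fun x => cutoff n k x * moll φ v x) x = _ := h1.fderiv
  rw [← partialD_moll φ hv h i x, partialD, h2]
  simp [partialD, mul_comm]

/-- Test functions are dense in `H¹`. -/
theorem denseRange_testH1 :
    DenseRange (fun φ : {φ : Rn n → ℝ // IsTest φ} => testH1 φ.1 φ.2) := by
  intro v
  have hv := Lp.memLp (toL2 v)
  have hw : HasWeakGradient (toL2 v) (grad v) := v.2
  have hm (k : ℕ) {f : Rn n → ℝ} (hf : MemLp f 2 volume) :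
      AEStronglyMeasurable (moll (mollifier n k) f) volume :=
    (contDiff_moll _ hf).continuous.aestronglyMeasurable
  -- Mollification gives smoothness and commutes with the weak gradient; the cutoff then gives
  -- compact support.
  set φ : ℕ → Rn n → ℝ := fun k x => cutoff n k x * moll (mollifier n k) (toL2 v) x
  have hφ (k : ℕ) : IsTest (φ k) := isTest_cutoff_mul_moll k _ hv
  refine mem_closure_of_tendsto (f := fun k => testH1 (φ k) (hφ k)) (b := atTop) ?_
    (Eventually.of_forall fun k => ⟨⟨φ k, hφ k⟩, rfl⟩)
  have h1 : Tendsto (fun k => toL2 (testH1 (φ k) (hφ k))) atTop (𝓝 (toL2 v)) := by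
    rw [Lp.tendsto_Lp_iff_tendsto_eLpNorm']
    refine (tendsto_eLpNorm_cutoff_mul_sub hv (fun k => hm k hv)
      (tendsto_eLpNorm_moll_sub hv)).congr fun k => eLpNorm_congr_ae ?_
    filter_upwards [(hφ k).memLp.coeFn_toLp] with x hx
    rw [toL2_testH1, Pi.sub_apply, hx]
  have h2 : Tendsto (fun k => grad (testH1 (φ k) (hφ k))) atTop (𝓝 (grad v)) := by
    rw [Lp.tendsto_Lp_iff_tendsto_eLpNorm']
    have hi (i : Fin n) : Tendsto (fun k => eLpNorm (fun x =>
        (cutoff n k x * moll (mollifier n k) (fun y => grad v y i) x - grad v x i)) 2 volume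
        + eLpNorm (fun x => partialD i (cutoff n k) x * moll (mollifier n k) (toL2 v) x) 2 volume)
        atTop (𝓝 0) := by
      have hg := memLp_coord (grad v) i
      simpa using (tendsto_eLpNorm_cutoff_mul_sub hg (fun k => hm k hg)
        (tendsto_eLpNorm_moll_sub hg)).add (tendsto_eLpNorm_partialD_cutoff_mul hv
          (fun k => hm k hv) (tendsto_eLpNorm_moll_sub hv) i)
    have hsum := tendsto_finsetSum Finset.univ fun i _ => hi i
    refine tendsto_of_tendsto_of_tendsto_of_le_of_le tendsto_const_nhds (by simpa using hsum)
      (fun _ => zero_le) fun k => ?_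
    refine (eLpNorm_le_sum_coord ((Lp.aestronglyMeasurable _).sub
      (Lp.aestronglyMeasurable _))).trans (Finset.sum_le_sum fun i _ => ?_)
    have hg := memLp_coord (grad v) i
    have hc := (isTest_cutoff n k).1.continuous.aestronglyMeasurable (μ := volume)
    have hd := ((isTest_cutoff n k).continuous_partialD i).aestronglyMeasurable (μ := volume)
    refine le_trans (le_of_eq ?_) (eLpNorm_add_le ((hc.mul (hm k hg)).sub hg.1)
      (hd.mul (hm k hv)) (by norm_num))
    refine eLpNorm_congr_ae ?_
    filter_upwards [(hφ k).memLp_gradVec.coeFn_toLp] with x hx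
    rw [grad_testH1, Pi.sub_apply, hx]
    have := partialD_cutoff_mul_moll k (mollifier n k) hv hw i x
    simp only [gradVec, PiLp.sub_apply, Pi.add_apply, φ, this]
    ring
  rw [tendsto_iff_norm_sub_tendsto_zero] at h1 h2 ⊢
  exact squeeze_zero (fun _ => norm_nonneg _) (fun k => H1.norm_le_add _) (by simpa [toL2_sub, grad_sub] using h1.add h2)

end Density

/-! ### The weak form of `A`. -/

section IntegrationByParts

theorem IsTest.partialD {φ : Rn n → ℝ} (h : IsTest φ) (i : Fin n) : IsTest (partialD i φ) := by
  constructor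
  · exact (h.1.fderiv_right (m := ∞) (by simp)).clm_apply contDiff_const
  · exact (h.2.fderiv (𝕜 := ℝ)).comp_left
      (g := fun L : Rn n →L[ℝ] ℝ => L (EuclideanSpace.single i 1)) (by simp)

theorem IsTest.laplacian_eq {φ : Rn n → ℝ} (h : IsTest φ) (x : Rn n) :
    Δ φ x = ∑ i, HeatRn.partialD i (HeatRn.partialD i φ) x := by
  rw [InnerProductSpace.laplacian_eq_iteratedFDeriv_orthonormalBasis φ
    (EuclideanSpace.basisFun (Fin n) ℝ)]
  refine Finset.sum_congr rfl fun i _ => ?_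
  have hd : DifferentiableAt ℝ (fderiv ℝ φ) x :=
    (h.1.fderiv_right (m := ∞) (by simp)).differentiable (by simp) x
  have h1 : fderiv ℝ (fun y => fderiv ℝ φ y (EuclideanSpace.single i 1)) x = _ :=
    (hd.hasFDerivAt.clm_apply (hasFDerivAt_const (EuclideanSpace.single i (1 : ℝ)) x)).fderiv
  rw [iteratedFDeriv_two_apply]
  change _ = fderiv ℝ (fun y => fderiv ℝ φ y (EuclideanSpace.single i 1)) x _
  rw [h1]
  simp

/-- Integration by parts: `(A v, w)_{L²} = (∇v, ∇w)_{L²}` for `v ∈ D(A)` and `w ∈ H¹`. -/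
theorem IsNegLaplacian.inner_toL2 {v : H1 n} {a : L2 n} (h : IsNegLaplacian v a) (w : H1 n) :
    inner ℝ a (toL2 w) = inner ℝ (grad v) (grad w) := by
  -- Both sides are continuous in `w ∈ H¹`, so `w` may be a test function `φ`; the weak gradient of
  -- `v` is then tested against each `∂ᵢφ`.
  refine denseRange_testH1.induction_on (p := fun w => inner ℝ a (toL2 w) =
    inner ℝ (grad v) (grad w)) w ?_ ?_
  · exact isClosed_eq (continuous_const.inner continuous_toL2)
      (continuous_const.inner continuous_grad)
  rintro ⟨φ, hφ⟩
  have e1 : inner ℝ a (toL2 (testH1 φ hφ)) = ∫ x, a x * φ x := by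
    rw [L2.inner_def]
    refine integral_congr_ae ?_
    filter_upwards [hφ.memLp.coeFn_toLp] with x hx
    simp [toL2_testH1, hx, mul_comm]
  have e2 : inner ℝ (grad v) (grad (testH1 φ hφ)) = ∫ x, ∑ i, grad v x i * partialD i φ x := by
    rw [L2.inner_def]
    refine integral_congr_ae ?_
    filter_upwards [hφ.memLp_gradVec.coeFn_toLp] with x hx
    simp [grad_testH1, hx, PiLp.inner_apply, gradVec, mul_comm]
  simp only [e1, e2]
  rw [h.2 φ hφ, integral_finsetSum (f := fun i x => grad v x i * HeatRn.partialD i φ x) _ fun i _ =>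
    (memLp_coord (grad v) i).integrable_mul (hφ.memLp_partialD i)]
  simp only [hφ.laplacian_eq, Finset.mul_sum]
  rw [integral_finsetSum
    (f := fun i x => toL2 v x * HeatRn.partialD i (HeatRn.partialD i φ) x) _ fun i _ =>
    (Lp.memLp (toL2 v)).integrable_mul ((hφ.partialD i).memLp_partialD i), ← Finset.sum_neg_distrib]
  refine Finset.sum_congr rfl fun i _ => ?_
  rw [neg_eq_iff_eq_neg]
  exact v.2 _ (hφ.partialD i) i

end IntegrationByParts

/-! ### The critical Sobolev inequality. -/

section Sobolev

/-- The critical Sobolev exponent `2n / (n - 2)`. -/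
def sobolevExp (n : ℕ) : NNReal := Real.toNNReal (2 * n / (n - 2))

theorem coe_sobolevExp (hn : 3 ≤ n) : (sobolevExp n : ℝ) = 2 * n / (n - 2) := by
  have : (3 : ℝ) ≤ n := by exact_mod_cast hn
  exact Real.coe_toNNReal _ (div_nonneg (by linarith) (by linarith))

theorem norm_fderiv_le (φ : Rn n → ℝ) (x : Rn n) : ‖fderiv ℝ φ x‖ ≤ ‖gradVec φ x‖ := by
  refine ContinuousLinearMap.opNorm_le_bound _ (norm_nonneg _) fun y => ?_
  have h : fderiv ℝ φ x y = inner ℝ (gradVec φ x) y := by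
    conv_lhs => rw [← (EuclideanSpace.basisFun (Fin n) ℝ).sum_repr y]
    simp [PiLp.inner_apply, gradVec, partialD]
  rw [h]
  exact norm_inner_le_norm _ _

theorem exists_sobolev_testH1 (hn : 3 ≤ n) : ∃ S : NNReal, ∀ (φ : Rn n → ℝ) (hφ : IsTest φ),
    eLpNorm φ (sobolevExp n) volume ≤ S * ‖testH1 φ hφ‖ₑ := by
  have hn' : (3 : ℝ) ≤ n := by exact_mod_cast hn
  refine ⟨eLpNormLESNormFDerivOfEqInnerConst (volume : Measure (Rn n)) 2, fun φ hφ => ?_⟩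
  have h := eLpNorm_le_eLpNorm_fderiv_of_eq_inner (volume : Measure (Rn n)) (u := φ)
    (p := 2) (p' := sobolevExp n) (hφ.1.of_le (by simp)) hφ.2 (by norm_num)
    (by simp; omega) (by
      rw [coe_sobolevExp hn]
      have : (n : ℝ) - 2 ≠ 0 := by linarith
      simp
      field_simp)
  refine h.trans ?_
  gcongr
  · exact le_rfl
  calc eLpNorm (fderiv ℝ φ) 2 volume ≤ eLpNorm (gradVec φ) 2 volume :=
        eLpNorm_mono (norm_fderiv_le φ)
    _ = ‖grad (testH1 φ hφ)‖ₑ := by rw [grad_testH1, Lp.enorm_toLp]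
    _ ≤ _ := enorm_le_iff_norm_le.2 (norm_grad_le _)

/-- The Sobolev inequality on `H¹(ℝⁿ)`. -/
theorem exists_sobolev (hn : 3 ≤ n) : ∃ S : NNReal, ∀ v : H1 n,
    eLpNorm (toL2 v) (sobolevExp n) volume ≤ S * ‖v‖ₑ := by
  obtain ⟨S, hS⟩ := exists_sobolev_testH1 hn
  refine ⟨S, fun v => ?_⟩
  obtain ⟨w, hw, hlim⟩ := mem_closure_iff_seq_limit.1 (denseRange_testH1 v)
  choose φ hφ using hw
  have h1 : Tendsto (fun k => toL2 (w k)) atTop (𝓝 (toL2 v)) :=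
    (continuous_toL2.tendsto v).comp hlim
  -- It is not known beforehand that `v` lies in the Sobolev space exponent's `Lᵖ`; Fatou along an
  -- a.e. convergent subsequence transfers the bound.
  obtain ⟨ns, hns, hae⟩ := (tendstoInMeasure_of_tendsto_Lp h1).exists_seq_tendsto_ae
  refine (Lp.eLpNorm_lim_le_liminf_eLpNorm (fun k => Lp.aestronglyMeasurable _) _ hae).trans ?_
  have h2 : Tendsto (fun k => (S : ℝ≥0∞) * ‖w (ns k)‖ₑ) atTop (𝓝 (S * ‖v‖ₑ)) :=
    ENNReal.Tendsto.const_mul (hlim.comp hns.tendsto_atTop).enorm (Or.inr (by simp))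
  rw [← h2.liminf_eq]
  refine liminf_le_liminf (Eventually.of_forall fun k => ?_)
  refine le_trans (le_of_eq ?_) ((hS _ (φ (ns k)).2).trans_eq (by rw [← hφ (ns k)]))
  refine eLpNorm_congr_ae ?_
  rw [← hφ (ns k)]
  exact (φ (ns k)).2.memLp.coeFn_toLp

end Sobolev

/-! ### Nemytskii operators from `H¹` to `L²`. -/

section Nemytskii

theorem exponent_pos (hn : 3 ≤ n) : 0 < (2 : ℝ) / ((n : ℝ) - 2) := by
  have hn' : (3 : ℝ) ≤ n := by exact_mod_cast hn
  exact div_pos two_pos (by linarith)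

/-- The growth condition makes `F(x, ·)` locally Lipschitz continuous. -/
theorem GrowthCondition.abs_sub_le (hn : 3 ≤ n) {C : ℝ} (hC : 0 < C) {F : Rn n → ℝ → ℝ}
    (hF : IsNonlinearity F) (h : GrowthCondition C F) (x : Rn n) (s r : ℝ) :
    |F x s - F x r| ≤ C * (|s - r| + |s| ^ ((2 : ℝ) / ((n : ℝ) - 2)) * |s - r|
      + |r| ^ ((2 : ℝ) / ((n : ℝ) - 2)) * |s - r|) := by
  have hβ := exponent_pos hn
  set β := (2 : ℝ) / ((n : ℝ) - 2)
  -- Between `r` and `s` one has `|ξ| ≤ max |s| |r|`, hence `|ξ|^β ≤ |s|^β + |r|^β`; the mean value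
  -- inequality then applies.
  have hd (ξ : ℝ) (hξ : ξ ∈ uIcc r s) : ‖deriv (F x) ξ‖ ≤ C * (1 + |s| ^ β + |r| ^ β) := by
    refine (h.2 x ξ).trans ?_
    have h1 : |ξ| ≤ max |s| |r| := by
      rw [max_comm]
      rcases le_total r s with hrs | hrs
      · rw [uIcc_of_le hrs] at hξ
        exact abs_le_max_abs_abs hξ.1 hξ.2
      · rw [uIcc_of_ge hrs] at hξ
        rw [max_comm]
        exact abs_le_max_abs_abs hξ.1 hξ.2
    have h2 : |ξ| ^ β ≤ |s| ^ β + |r| ^ β := by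
      refine (Real.rpow_le_rpow (abs_nonneg _) h1 hβ.le).trans ?_
      have hs := Real.rpow_nonneg (abs_nonneg s) β
      have hr := Real.rpow_nonneg (abs_nonneg r) β
      rcases max_choice |s| |r| with e | e <;> rw [e] <;> linarith
    exact mul_le_mul_of_nonneg_left (by linarith) hC.le
  have := (convex_uIcc r s).norm_image_sub_le_of_norm_deriv_le
    (fun ξ _ => ((hF.2 x).differentiable (by simp)).differentiableAt) hd left_mem_uIcc right_mem_uIcc
  rw [Real.norm_eq_abs, Real.norm_eq_abs] at this
  linarith

theorem aestronglyMeasurable_nemytskii {F : Rn n → ℝ → ℝ} (hF : IsNonlinearity F) {v : Rn n → ℝ}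
    (hv : AEStronglyMeasurable v volume) :
    AEStronglyMeasurable (fun x => F x (v x)) volume :=
  hF.1.comp_aestronglyMeasurable (aestronglyMeasurable_id.prodMk hv)

/-- This is `1/n + (n-2)/(2n) = 1/2`: a factor in `Lⁿ` is what a Sobolev function needs to land in
`L²`. -/
theorem holderTriple_sobolevExp (hn : 3 ≤ n) :
    ENNReal.HolderTriple (n : ℝ≥0∞) (sobolevExp n) 2 := by
  have hn' : (3 : ℝ) ≤ n := by exact_mod_cast hn
  have hp := coe_sobolevExp hn
  have h0 : (0 : ℝ) < n - 2 := by linarith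
  refine ENNReal.HolderTriple.of_toReal ⟨?_, ?_, ?_⟩
  · simp only [ENNReal.toReal_natCast, ENNReal.coe_toReal, hp, ENNReal.toReal_ofNat]
    field_simp
    ring
  · simp only [ENNReal.toReal_natCast]
    linarith
  · simp only [ENNReal.coe_toReal, hp]
    positivity

theorem aestronglyMeasurable_rpow_mul (v z : H1 n) (β : ℝ) :
    AEStronglyMeasurable (fun x => |toL2 v x| ^ β * toL2 z x) volume :=
  ((Lp.aestronglyMeasurable (toL2 v)).norm.aemeasurable.pow_const β).aestronglyMeasurable.mul
    (Lp.aestronglyMeasurable (toL2 z))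

/-- The critical product estimate, from Hölder's and Sobolev's inequalities. -/
theorem exists_eLpNorm_rpow_mul_le (hn : 3 ≤ n) : ∃ S : NNReal, ∀ v z : H1 n,
    eLpNorm (fun x => |toL2 v x| ^ ((2 : ℝ) / ((n : ℝ) - 2)) * toL2 z x) 2 volume
      ≤ (S * ‖v‖ₑ) ^ ((2 : ℝ) / ((n : ℝ) - 2)) * (S * ‖z‖ₑ) := by
  obtain ⟨S, hS⟩ := exists_sobolev hn
  refine ⟨S, fun v z => ?_⟩
  have hβ := exponent_pos hn
  have hn' : (3 : ℝ) ≤ n := by exact_mod_cast hn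
  have := holderTriple_sobolevExp hn
  have h1 := eLpNorm_smul_le_mul_eLpNorm (p := (n : ℝ≥0∞)) (q := sobolevExp n) (r := 2)
    (Lp.aestronglyMeasurable (toL2 z))
    (φ := fun x => ‖toL2 v x‖ ^ ((2 : ℝ) / ((n : ℝ) - 2)))
    ((Lp.aestronglyMeasurable (toL2 v)).norm.aemeasurable.pow_const _).aestronglyMeasurable
  rw [eLpNorm_norm_rpow _ hβ] at h1
  -- Criticality of `β`: since `n β = 2n/(n-2)`, the `Lⁿ` norm of `|v|^β` is a power of the Sobolev
  -- norm of `v`.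
  have e : (n : ℝ≥0∞) * ENNReal.ofReal ((2 : ℝ) / ((n : ℝ) - 2)) = sobolevExp n := by
    rw [← ENNReal.ofReal_natCast, ← ENNReal.ofReal_mul (by positivity)]
    rw [sobolevExp, ENNReal.ofReal]
    congr 2
    ring
  rw [e] at h1
  refine h1.trans ?_
  gcongr
  · exact hS v
  · exact hS z

theorem eLpNorm_toL2_le (v : H1 n) : eLpNorm (toL2 v) 2 volume ≤ ‖v‖ₑ := by
  rw [← Lp.enorm_def]
  exact enorm_le_iff_norm_le.2 (norm_toL2_le v)

set_option maxHeartbeats 800000 in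
/-- The Nemytskii operators are Lipschitz continuous from bounded subsets of `H¹` to `L²`,
uniformly over all nonlinearities with the same growth constant. -/
theorem exists_lipschitz_nemytskii (hn : 3 ≤ n) {C : ℝ} (hC : 0 < C) (R : ℝ) :
    ∃ L : ℝ, 1 ≤ L ∧ ∀ F : Rn n → ℝ → ℝ, IsNonlinearity F → GrowthCondition C F →
      ∀ v w : H1 n, ‖v‖ ≤ R → ‖w‖ ≤ R →
        eLpNorm (fun x => F x (toL2 v x) - F x (toL2 w x)) 2 volume
          ≤ ENNReal.ofReal (L * ‖v - w‖) := by
  obtain ⟨S, hS⟩ := exists_eLpNorm_rpow_mul_le hn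
  have hβ := exponent_pos hn
  generalize hβdef : (2 : ℝ) / ((n : ℝ) - 2) = β at hS hβ
  obtain ⟨K, hK⟩ : ∃ K : NNReal, (K : ℝ≥0∞) = ENNReal.ofReal C *
      (1 + (S * ENNReal.ofReal R) ^ β * S + (S * ENNReal.ofReal R) ^ β * S) := by
    have h1 : (S * ENNReal.ofReal R) ^ β * S ≠ ⊤ :=
      ENNReal.mul_ne_top (ENNReal.rpow_ne_top_of_nonneg hβ.le
        (ENNReal.mul_ne_top (by simp) (by simp))) (by simp)
    exact ⟨_, ENNReal.coe_toNNReal (ENNReal.mul_ne_top (by simp)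
      (ENNReal.add_ne_top.2 ⟨ENNReal.add_ne_top.2 ⟨by simp, h1⟩, h1⟩))⟩
  -- The maximum with `1` keeps `L` positive, so that radii `ε / (3 L)` can be used later.
  refine ⟨max 1 (K : ℝ), le_max_left _ _, fun F hF hFC v w hv hw => ?_⟩
  obtain ⟨z, hzdef⟩ : ∃ z, z = v - w := ⟨_, rfl⟩
  have hz : ∀ᵐ x, toL2 z x = toL2 v x - toL2 w x := by
    filter_upwards [Lp.coeFn_sub (toL2 v) (toL2 w)] with x hx
    rw [hzdef, toL2_sub, hx, Pi.sub_apply]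
  have hvR : ‖v‖ₑ ≤ ENNReal.ofReal R := by
    rw [← ofReal_norm]; exact ENNReal.ofReal_le_ofReal hv
  have hwR : ‖w‖ₑ ≤ ENNReal.ofReal R := by
    rw [← ofReal_norm]; exact ENNReal.ofReal_le_ofReal hw
  rw [← hzdef]
  have hmz := (Lp.aestronglyMeasurable (toL2 z)).norm
  have hmv := (aestronglyMeasurable_rpow_mul v z β).norm
  have hmw := (aestronglyMeasurable_rpow_mul w z β).norm
  calc eLpNorm (fun x => F x (toL2 v x) - F x (toL2 w x)) 2 volume
      ≤ ENNReal.ofReal C * eLpNorm ((fun x => ‖toL2 z x‖) + (fun x => ‖|toL2 v x| ^ β * toL2 z x‖)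
          + (fun x => ‖|toL2 w x| ^ β * toL2 z x‖)) 2 volume := by
        refine eLpNorm_le_mul_eLpNorm_of_ae_le_mul ?_ 2
        filter_upwards [hz] with x hx
        have h0 := hFC.abs_sub_le hn hC hF x (toL2 v x) (toL2 w x)
        rw [hβdef, ← hx] at h0
        refine h0.trans ?_
        refine mul_le_mul_of_nonneg_left ?_ hC.le
        refine le_trans (le_of_eq ?_) (Real.le_norm_self _)
        simp [abs_of_nonneg (Real.rpow_nonneg (abs_nonneg _) β)]
    _ ≤ ENNReal.ofReal C * (eLpNorm (toL2 z) 2 volume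
          + eLpNorm (fun x => |toL2 v x| ^ β * toL2 z x) 2 volume
          + eLpNorm (fun x => |toL2 w x| ^ β * toL2 z x) 2 volume) := by
        refine mul_le_mul_right ((eLpNorm_add_le (hmz.add hmv) hmw (by norm_num)).trans
          (add_le_add ((eLpNorm_add_le hmz hmv (by norm_num)).trans
          (add_le_add (eLpNorm_norm _).le (eLpNorm_norm _).le)) (eLpNorm_norm _).le)) _
    _ ≤ ENNReal.ofReal C * (‖z‖ₑ + (S * ENNReal.ofReal R) ^ β * (S * ‖z‖ₑ)
          + (S * ENNReal.ofReal R) ^ β * (S * ‖z‖ₑ)) := by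
        gcongr
        · exact eLpNorm_toL2_le z
        · exact (hS v z).trans (by gcongr)
        · exact (hS w z).trans (by gcongr)
    _ = K * ‖z‖ₑ := by rw [hK]; ring
    _ ≤ ENNReal.ofReal (max 1 (K : ℝ) * ‖z‖) := by
        rw [ENNReal.ofReal_mul (by positivity), ofReal_norm]
        gcongr
        rw [← ENNReal.ofReal_coe_nnreal]
        exact ENNReal.ofReal_le_ofReal (le_max_right _ _)

/-- The part `G_j(·,0) - G(·,0)` tends to zero by assumption; what remains is dominated by `2C(|v| +
|v|^{1+β})`, which is in `L²` by the critical product estimate. -/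
theorem tendsto_nemytskii (hn : 3 ≤ n) {C : ℝ} (hC : 0 < C)
    {G : Rn n → ℝ → ℝ} {Gj : ℕ → Rn n → ℝ → ℝ}
    (hG : IsNonlinearity G) (hGj : ∀ j, IsNonlinearity (Gj j))
    (hGC : GrowthCondition C G) (hGjC : ∀ j, GrowthCondition C (Gj j))
    (hlim : ∀ (x : Rn n) (s : ℝ), Tendsto (fun j => Gj j x s) atTop (𝓝 (G x s)))
    (hlim0 : Tendsto (fun j => eLpNorm (fun x => Gj j x 0 - G x 0) 2 (volume : Measure (Rn n)))
      atTop (𝓝 0)) (v : H1 n) :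
    Tendsto (fun j => eLpNorm (fun x => Gj j x (toL2 v x) - G x (toL2 v x)) 2 volume)
      atTop (𝓝 0) := by
  obtain ⟨S, hS⟩ := exists_eLpNorm_rpow_mul_le hn
  have hβ := exponent_pos hn
  set β := (2 : ℝ) / ((n : ℝ) - 2) with hβdef
  have hmv := Lp.aestronglyMeasurable (toL2 v)
  have hm0 : AEStronglyMeasurable (fun _ : Rn n => (0 : ℝ)) volume := aestronglyMeasurable_const
  have hpv : MemLp (fun x => |toL2 v x| ^ β * toL2 v x) 2 volume :=
    ⟨aestronglyMeasurable_rpow_mul v v β, (hS v v).trans_lt (ENNReal.mul_lt_top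
      (ENNReal.rpow_lt_top_of_nonneg hβ.le (by finiteness)) (by finiteness))⟩
  have hb : MemLp (fun x => 2 * C * (|toL2 v x| + |toL2 v x| ^ β * |toL2 v x|)) 2 volume := by
    refine ((Lp.memLp (toL2 v)).norm.add (hpv.norm.ae_eq ?_)).const_mul _
    refine Eventually.of_forall fun x => ?_
    simp [abs_of_nonneg (Real.rpow_nonneg (abs_nonneg _) β)]
  have hF {F : Rn n → ℝ → ℝ} (h : IsNonlinearity F) (hc : GrowthCondition C F) (x : Rn n) (s : ℝ) :
      |F x s - F x 0| ≤ C * (|s| + |s| ^ β * |s|) := by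
    have := hc.abs_sub_le hn hC h x s 0
    simpa [← hβdef, Real.zero_rpow hβ.ne'] using this
  have hP := tendsto_eLpNorm_two_of_dominated (F := fun j x => (Gj j x (toL2 v x) - Gj j x 0)
      - (G x (toL2 v x) - G x 0)) hb
    (fun j => ((aestronglyMeasurable_nemytskii (hGj j) hmv).sub
      (aestronglyMeasurable_nemytskii (hGj j) hm0)).sub
      ((aestronglyMeasurable_nemytskii hG hmv).sub (aestronglyMeasurable_nemytskii hG hm0)))
    (fun j => Eventually.of_forall fun x => by
      refine (norm_sub_le _ _).trans ?_
      have h1 := hF (hGj j) (hGjC j) x (toL2 v x)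
      have h2 := hF hG hGC x (toL2 v x)
      rw [Real.norm_eq_abs, Real.norm_eq_abs]
      linarith)
    (Eventually.of_forall fun x => by
      have := ((hlim x (toL2 v x)).sub (hlim x 0)).sub_const (G x (toL2 v x) - G x 0)
      simpa using this)
  refine tendsto_of_tendsto_of_tendsto_of_le_of_le tendsto_const_nhds
    (by simpa using hP.add hlim0) (fun _ => zero_le) fun j => ?_
  refine le_trans (le_of_eq ?_) (eLpNorm_add_le (((aestronglyMeasurable_nemytskii (hGj j) hmv).sub
      (aestronglyMeasurable_nemytskii (hGj j) hm0)).sub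
      ((aestronglyMeasurable_nemytskii hG hmv).sub (aestronglyMeasurable_nemytskii hG hm0)))
    ((aestronglyMeasurable_nemytskii (hGj j) hm0).sub (aestronglyMeasurable_nemytskii hG hm0))
    (by norm_num))
  congr 1; ext x; simp only [Pi.add_apply]; ring

/-- The Nemytskii operators of `Gj` converge to that of `G`, uniformly on compact subsets of
`H¹`. -/
theorem eventually_nemytskii_le (hn : 3 ≤ n) {C : ℝ} (hC : 0 < C) (R : ℝ)
    {G : Rn n → ℝ → ℝ} {Gj : ℕ → Rn n → ℝ → ℝ}
    (hG : IsNonlinearity G) (hGj : ∀ j, IsNonlinearity (Gj j))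
    (hGC : GrowthCondition C G) (hGjC : ∀ j, GrowthCondition C (Gj j))
    (hlim : ∀ (x : Rn n) (s : ℝ), Tendsto (fun j => Gj j x s) atTop (𝓝 (G x s)))
    (hlim0 : Tendsto (fun j => eLpNorm (fun x => Gj j x 0 - G x 0) 2 (volume : Measure (Rn n)))
      atTop (𝓝 0)) {K : Set (H1 n)} (hK : IsCompact K) (hKR : ∀ v ∈ K, ‖v‖ ≤ R)
    {ε : ℝ} (hε : 0 < ε) :
    ∀ᶠ j in atTop, ∀ v ∈ K,
      eLpNorm (fun x => Gj j x (toL2 v x) - G x (toL2 v x)) 2 volume ≤ ENNReal.ofReal ε := by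
  obtain ⟨L, hL1, hL⟩ := exists_lipschitz_nemytskii hn hC R
  -- With this radius, moving from `v` to a centre costs at most `ε/3` for `G_j` and for `G`; the
  -- last third is convergence at the finitely many centres.
  have hρ : 0 < ε / (3 * L) := by positivity
  obtain ⟨t, htK, htf, hcov⟩ := hK.finite_cover_balls hρ
  have hev : ∀ᶠ j in atTop, ∀ w ∈ t,
      eLpNorm (fun x => Gj j x (toL2 w x) - G x (toL2 w x)) 2 volume ≤ ENNReal.ofReal (ε / 3) := by
    rw [eventually_all_finite htf]
    intro w _
    exact ENNReal.tendsto_nhds_zero.1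
      (tendsto_nemytskii hn hC hG hGj hGC hGjC hlim hlim0 w) _ (by simpa using hε)
  filter_upwards [hev] with j hj v hv
  obtain ⟨w, hw, hvw⟩ := mem_iUnion₂.1 (hcov hv)
  have hd : L * ‖v - w‖ ≤ ε / 3 := by
    have h1 : ‖v - w‖ ≤ ε / (3 * L) := by rw [← dist_eq_norm]; exact (Metric.mem_ball.1 hvw).le
    calc L * ‖v - w‖ ≤ L * (ε / (3 * L)) := by gcongr
      _ = ε / 3 := by field_simp
  have hd' : L * ‖w - v‖ ≤ ε / 3 := by rwa [norm_sub_rev]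
  have hm {F : Rn n → ℝ → ℝ} (h : IsNonlinearity F) (v : H1 n) :=
    aestronglyMeasurable_nemytskii h (Lp.aestronglyMeasurable (toL2 v))
  have hjv := (hL _ (hGj j) (hGjC j) v w (hKR v hv) (hKR w (htK hw))).trans
    (ENNReal.ofReal_le_ofReal hd)
  have hgv := (hL _ hG hGC w v (hKR w (htK hw)) (hKR v hv)).trans (ENNReal.ofReal_le_ofReal hd')
  calc eLpNorm (fun x => Gj j x (toL2 v x) - G x (toL2 v x)) 2 volume
      = eLpNorm ((fun x => Gj j x (toL2 v x) - Gj j x (toL2 w x))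
          + (fun x => Gj j x (toL2 w x) - G x (toL2 w x))
          + (fun x => G x (toL2 w x) - G x (toL2 v x))) 2 volume := by
        congr 1; ext x; simp
    _ ≤ ENNReal.ofReal (ε / 3) + ENNReal.ofReal (ε / 3) + ENNReal.ofReal (ε / 3) := by
        refine (eLpNorm_add_le (((hm (hGj j) v).sub (hm (hGj j) w)).add
          ((hm (hGj j) w).sub (hm hG w))) ((hm hG w).sub (hm hG v)) (by norm_num)).trans ?_
        refine add_le_add ?_ hgv
        exact (eLpNorm_add_le ((hm (hGj j) v).sub (hm (hGj j) w))
          ((hm (hGj j) w).sub (hm hG w)) (by norm_num)).trans (add_le_add hjv (hj w hw))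
    _ = ENNReal.ofReal ε := by
        rw [← ENNReal.ofReal_add (by positivity) (by positivity),
          ← ENNReal.ofReal_add (by positivity) (by positivity)]
        congr 1; ring

end Nemytskii

/-! ### Grönwall's inequality with left Dini derivatives. -/

section Gronwall

/-- Under the reflection `s ↦ -E (-s)` left difference quotients become right ones and `K` becomes
`-K`. The usual Grönwall bound, started at `-b`, is then solved for `E b`. -/
theorem le_exp_mul_of_left_dini_aux {E : ℝ → ℝ} {K κ a b : ℝ} (hK : 0 < K) (hκ : 0 ≤ κ)
    (hab : a ≤ b) (hE : ContinuousOn E (Icc a b))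
    (hd : ∀ t ∈ Ioc a b, ∀ r, K * E t + κ < r → ∀ᶠ s in 𝓝[<] t, E t - E s < r * (t - s)) :
    E b ≤ Real.exp (K * (b - a)) * (E a + κ / K) := by
  have h := le_gronwallBound_of_liminf_deriv_right_le (f := fun s => -E (-s))
    (f' := fun s => K * E (-s) + κ) (δ := -E b) (K := -K) (ε := κ) (a := -b) (b := -a)
    ?_ ?_ (by simp) (fun x _ => by linarith) (-a) ⟨by linarith, le_rfl⟩
  · rw [gronwallBound_of_K_ne_0 (by linarith)] at h
    simp only [neg_neg] at h
    have e : -a - -b = b - a := by ring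
    rw [e] at h
    have h1 : Real.exp (K * (b - a)) * Real.exp (-K * (b - a)) = 1 := by
      rw [← Real.exp_add]; simp
    have h2 := mul_le_mul_of_nonneg_left h (Real.exp_pos (K * (b - a))).le
    have h3 : Real.exp (K * (b - a)) * (-E b * Real.exp (-K * (b - a))
        + κ / -K * (Real.exp (-K * (b - a)) - 1))
        = -E b * (Real.exp (K * (b - a)) * Real.exp (-K * (b - a)))
          - κ / K * (Real.exp (K * (b - a)) * Real.exp (-K * (b - a)))
          + κ / K * Real.exp (K * (b - a)) := by
      rw [div_neg]; ring
    rw [h3, h1] at h2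
    have : 0 ≤ κ / K := by positivity
    linarith
  · refine (hE.comp continuous_neg.continuousOn ?_).neg
    intro x hx
    exact ⟨by linarith [hx.2], by linarith [hx.1]⟩
  · intro x hx r hr
    have h1 := hd (-x) ⟨by linarith [hx.2], by linarith [hx.1]⟩ r hr
    have h2 : Tendsto (fun z : ℝ => -z) (𝓝[>] x) (𝓝[<] (-x)) := tendsto_neg_nhdsGT
    refine Eventually.frequently ?_
    filter_upwards [h2.eventually h1, self_mem_nhdsWithin] with z hz hxz
    have hxz' : 0 < z - x := sub_pos.2 hxz
    rw [inv_mul_lt_iff₀ hxz']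
    linarith

/-- Grönwall's inequality for a continuous function whose upper left Dini derivative is bounded
in the open interval. -/
theorem le_exp_mul_of_left_dini {E : ℝ → ℝ} {K κ T : ℝ} (hK : 0 < K) (hκ : 0 ≤ κ) (hT : 0 < T)
    (hE : ContinuousOn E (Icc 0 T))
    (hd : ∀ t ∈ Ioo 0 T, ∀ r, K * E t + κ < r → ∀ᶠ s in 𝓝[<] t, E t - E s < r * (t - s)) :
    ∀ t ∈ Icc 0 T, E t ≤ Real.exp (K * t) * (E 0 + κ / K) := by
  -- Nothing is assumed on the rate at `0` or `T`: start at `a > 0` and let `a → 0` by continuity,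
  -- then extend to the endpoints by continuity in `t`.
  have h1 : ∀ b ∈ Ioo 0 T, E b ≤ Real.exp (K * b) * (E 0 + κ / K) := by
    intro b hb
    have hsub : Ioo 0 b ⊆ Icc 0 T := fun s hs => ⟨hs.1.le, hs.2.le.trans hb.2.le⟩
    have h0 : (0 : ℝ) ∈ closure (Ioo 0 b) := by
      rw [closure_Ioo hb.1.ne]; exact ⟨le_rfl, hb.1.le⟩
    have hE0 : ContinuousWithinAt E (Ioo 0 b) 0 := (hE 0 ⟨le_rfl, hT.le⟩).mono hsub
    have := ContinuousWithinAt.closure_le h0 (f := fun _ => E b)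
      (g := fun a => Real.exp (K * (b - a)) * (E a + κ / K)) continuousWithinAt_const
      ((by fun_prop : Continuous fun a => Real.exp (K * (b - a))).continuousWithinAt.mul
        (hE0.add continuousWithinAt_const)) fun a ha => ?_
    · simpa using this
    · exact le_exp_mul_of_left_dini_aux hK hκ ha.2.le
        (hE.mono fun s hs => ⟨ha.1.le.trans hs.1, hs.2.trans hb.2.le⟩)
        fun t ht => hd t ⟨ha.1.trans ht.1, ht.2.trans_lt hb.2⟩
  intro t ht
  have htc : t ∈ closure (Ioo 0 T) := by rwa [closure_Ioo hT.ne]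
  exact ContinuousWithinAt.closure_le htc ((hE t ht).mono Ioo_subset_Icc_self)
    (by fun_prop : Continuous fun t => Real.exp (K * t) * (E 0 + κ / K)).continuousWithinAt h1

end Gronwall

/-! ### The weighted energy estimate. -/

section Energy

/-- `w` satisfies `w' + A w = h` at time `t`, with `A w` in weak form, and with a source `h` which
is bounded by `L ‖w‖_{H¹} + ε`. -/
def PerturbedHeatAt (L ε : ℝ) (w : ℝ → H1 n) (t : ℝ) : Prop :=
  ∃ d a : L2 n, HasDerivAt (fun s => toL2 (w s)) d t ∧
    (∀ z : H1 n, inner ℝ a (toL2 z) = inner ℝ (grad (w t)) (grad z)) ∧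
    ‖d + a‖ ≤ L * ‖w t‖ + ε

/-- Here `X = ‖w‖`, `y = ‖∇w‖`, `A = ‖a‖`, `H = ‖d + a‖`, `N = ‖w‖_{H¹}`. Young's inequality gives
`2 wd ≤ (L²+2) X² - y² + ε²` and `2 ad ≤ L² (X² + y²) + ε²`. As `φ ≤ 1 + T`, the choice of `M`
ensures `φ L² + q ≤ M`, so `-M y²` absorbs all gradient terms, and `φ ≤ M` bounds the `ε²` terms. -/
theorem energy_rate_le {L ε T M φ q X y A H N wd ad wh ah : ℝ}
    (hM : M = 1 + (1 + T) * (L ^ 2 + 1)) (hT : 0 ≤ T) (hφ0 : 0 ≤ φ) (hφ : φ ≤ 1 + T) (hq : q ≤ 1)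
    (hX : 0 ≤ X) (hH0 : 0 ≤ H) (hNsq : N ^ 2 = X ^ 2 + y ^ 2)
    (hH : H ≤ L * N + ε) (hwd : wd = wh - y ^ 2) (had : ad = ah - A ^ 2)
    (hwh : wh ≤ X * H) (hah : ah ≤ A * H) :
    M * (2 * wd) + q * y ^ 2 + 2 * φ * ad
      ≤ (L ^ 2 + 3) * (M * X ^ 2 + φ * y ^ 2) + 2 * M * ε ^ 2 := by
  have hM0 : 0 ≤ M := by rw [hM]; positivity
  have h1 : 2 * wh ≤ (L ^ 2 + 2) * X ^ 2 + y ^ 2 + ε ^ 2 := by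
    have : X * H ≤ X * (L * N + ε) := by gcongr
    nlinarith [sq_nonneg (L * X - N), sq_nonneg (X - ε)]
  have hHsq : H ^ 2 ≤ 2 * L ^ 2 * (X ^ 2 + y ^ 2) + 2 * ε ^ 2 := by
    have : H ^ 2 ≤ (L * N + ε) ^ 2 := by gcongr
    rw [← hNsq]
    nlinarith [sq_nonneg (L * N - ε)]
  have h2 : 2 * ad ≤ L ^ 2 * (X ^ 2 + y ^ 2) + ε ^ 2 := by
    nlinarith [sq_nonneg (2 * A - H)]
  have h3 := mul_le_mul_of_nonneg_left h1 hM0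
  have h4 := mul_le_mul_of_nonneg_left h2 hφ0
  have hφL : φ * L ^ 2 ≤ M - 1 := by
    have : φ * L ^ 2 ≤ (1 + T) * L ^ 2 := by gcongr
    rw [hM]; nlinarith
  have hφM : φ ≤ M := by rw [hM]; nlinarith [mul_nonneg (by linarith : 0 ≤ 1 + T) (sq_nonneg L)]
  have h5 := mul_le_mul_of_nonneg_right hφL (sq_nonneg X)
  have h6 := mul_le_mul_of_nonneg_right hφL (sq_nonneg y)
  have h7 := mul_le_mul_of_nonneg_right hφM (sq_nonneg ε)
  have h8 := mul_le_mul_of_nonneg_right hq (sq_nonneg y)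
  have h9 : 0 ≤ (L ^ 2 + 3) * (φ * y ^ 2) := by positivity
  rw [hwd]
  nlinarith [sq_nonneg X]

/-- The energy estimate for the perturbed heat equation, with a weight `p + q t` on the gradient
term. -/
theorem energy_le {L ε T p q : ℝ} (hT : 0 < T) (hp0 : 0 ≤ p) (hp : p ≤ 1)
    (hq0 : 0 ≤ q) (hq : q ≤ 1) {w : ℝ → H1 n} (hw : ContinuousOn w (Icc 0 T))
    (h : ∀ t ∈ Ioo 0 T, PerturbedHeatAt L ε w t) {M : ℝ} (hM : M = 1 + (1 + T) * (L ^ 2 + 1))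
    {t : ℝ} (ht : t ∈ Icc 0 T) :
    M * ‖toL2 (w t)‖ ^ 2 + (p + q * t) * ‖grad (w t)‖ ^ 2
      ≤ Real.exp ((L ^ 2 + 3) * t) * (M * ‖toL2 (w 0)‖ ^ 2 + p * ‖grad (w 0)‖ ^ 2
        + 2 * M * ε ^ 2 / (L ^ 2 + 3)) := by
  have hM0 : 0 ≤ M := by rw [hM]; positivity
  have hg : ContinuousOn (fun s => grad (w s)) (Icc 0 T) := continuous_grad.comp_continuousOn hw
  have hl : ContinuousOn (fun s => toL2 (w s)) (Icc 0 T) := continuous_toL2.comp_continuousOn hw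
  have key := le_exp_mul_of_left_dini (E := fun t => M * ‖toL2 (w t)‖ ^ 2
      + (p + q * t) * ‖grad (w t)‖ ^ 2) (K := L ^ 2 + 3) (κ := 2 * M * ε ^ 2) (T := T)
    (by positivity) (by positivity) hT ?_ ?_ t ht
  · simpa using key
  · exact (continuousOn_const.mul (hl.norm.pow 2)).add
      ((by fun_prop : Continuous fun t => p + q * t).continuousOn.mul (hg.norm.pow 2))
  intro t ht r hr
  obtain ⟨d, a, hd, ha, hh⟩ := h t ht
  set φ := p + q * t with hφ
  have hφ0 : 0 ≤ φ := add_nonneg hp0 (mul_nonneg hq0 ht.1.le)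
  have hφ1 : φ ≤ 1 + T := by nlinarith [ht.1, ht.2]
  -- With `φ` and `a` frozen at time `t`, the weighted gradient term is replaced by its
  -- linearization `2 φ (a, w(s))`, which is differentiable because `w` is so into `L²`.
  have hΨ : HasDerivAt (fun s => M * ‖toL2 (w s)‖ ^ 2 + 2 * φ * inner ℝ a (toL2 (w s)))
      (M * (2 * inner ℝ (toL2 (w t)) d) + 2 * φ * inner ℝ a d) t := by
    refine (hd.norm_sq.const_mul M).add (HasDerivAt.const_mul (2 * φ) ?_)
    simpa using (hasDerivAt_const t a).inner ℝ hd
  have hnhds : Icc 0 T ∈ 𝓝 t := Icc_mem_nhds ht.1 ht.2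
  have hgt : ContinuousAt (fun s => grad (w s)) t := hg.continuousAt hnhds
  have hlim : Tendsto (fun s => slope (fun s => M * ‖toL2 (w s)‖ ^ 2
      + 2 * φ * inner ℝ a (toL2 (w s))) t s + q * ‖grad (w s)‖ ^ 2) (𝓝[<] t)
      (𝓝 (M * (2 * inner ℝ (toL2 (w t)) d) + 2 * φ * inner ℝ a d + q * ‖grad (w t)‖ ^ 2)) := by
    refine (hΨ.tendsto_slope.mono_left (nhdsLT_le_nhdsNE t)).add ?_
    exact ((hgt.norm.pow 2).const_mul q).tendsto.mono_left nhdsWithin_le_nhds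
  have hrate := energy_rate_le (q := q) (X := ‖toL2 (w t)‖) (y := ‖grad (w t)‖) (A := ‖a‖)
    (H := ‖d + a‖) (N := ‖w t‖) (wd := inner ℝ (toL2 (w t)) d) (ad := inner ℝ a d)
    (wh := inner ℝ (toL2 (w t)) (d + a)) (ah := inner ℝ a (d + a)) hM hT.le hφ0 hφ1 hq
    (norm_nonneg _) (norm_nonneg _) (H1.norm_sq _) hh
    (by
      have := ha (w t)
      rw [real_inner_self_eq_norm_sq, real_inner_comm] at this
      rw [inner_add_right, this]; ring)
    (by rw [inner_add_right, real_inner_self_eq_norm_sq]; ring)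
    (real_inner_le_norm _ _) (real_inner_le_norm _ _)
  have hlt := hlim.eventually_lt_const (u := r) (by linarith)
  filter_upwards [hlt, self_mem_nhdsWithin] with s hs hst
  have hst' : s < t := hst
  have hpos : 0 < t - s := sub_pos.2 hst'
  -- Convexity of the squared norm: its increment is at most the linearized one at `t`. Dividing by
  -- `t - s` gives an upper bound only for `s < t`, hence the left Dini derivative.
  have hconv : ‖grad (w t)‖ ^ 2 - ‖grad (w s)‖ ^ 2
      ≤ 2 * (inner ℝ a (toL2 (w t)) - inner ℝ a (toL2 (w s))) := by
    rw [ha (w t), ha (w s), real_inner_self_eq_norm_sq]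
    nlinarith [real_inner_le_norm (grad (w t)) (grad (w s)),
      sq_nonneg (‖grad (w t)‖ - ‖grad (w s)‖)]
  have h1 := mul_le_mul_of_nonneg_left hconv hφ0
  have h2 := mul_lt_mul_of_pos_right hs hpos
  rw [add_mul, slope_def_field, ← neg_sub t s, div_neg, neg_mul, div_mul_cancel₀ _ hpos.ne'] at h2
  simp only [hφ] at h1 h2 ⊢
  linarith

end Energy

/-! ### From the energy estimate to uniform convergence. -/

section Main

theorem IsNegLaplacian.inner_sub {v v' : H1 n} {a a' : L2 n} (h : IsNegLaplacian v a)
    (h' : IsNegLaplacian v' a') (z : H1 n) :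
    inner ℝ (a - a') (toL2 z) = inner ℝ (grad (v - v')) (grad z) := by
  rw [inner_sub_left, grad_sub, inner_sub_left, h.inner_toL2, h'.inner_toL2]

/-- The difference of two solutions solves a perturbed heat equation. -/
theorem IsSolution.perturbedHeatAt_sub {F G : Rn n → ℝ → ℝ} {T L ε : ℝ} {u v : ℝ → H1 n}
    (hu : IsSolution F T u) (hv : IsSolution G T v) (hF : IsNonlinearity F)
    (hG : IsNonlinearity G) (hL : 0 ≤ L) (hε : 0 ≤ ε) {t : ℝ} (ht : t ∈ Ioo 0 T)
    (h1 : eLpNorm (fun x => F x (toL2 (u t) x) - F x (toL2 (v t) x)) 2 volume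
      ≤ ENNReal.ofReal (L * ‖u t - v t‖))
    (h2 : eLpNorm (fun x => F x (toL2 (v t) x) - G x (toL2 (v t) x)) 2 volume
      ≤ ENNReal.ofReal ε) :
    PerturbedHeatAt L ε (fun s => u s - v s) t := by
  obtain ⟨d, a, hd, ha, hda⟩ := hu.2 t ht
  obtain ⟨d', a', hd', ha', hda'⟩ := hv.2 t ht
  refine ⟨d - d', a - a', hd.sub hd', ha.inner_sub ha', ?_⟩
  have hm {F : Rn n → ℝ → ℝ} (h : IsNonlinearity F) (v : H1 n) :=
    aestronglyMeasurable_nemytskii h (Lp.aestronglyMeasurable (toL2 v))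
  have hle : ‖d - d' + (a - a')‖ₑ ≤ ENNReal.ofReal (L * ‖u t - v t‖ + ε) := by
    rw [Lp.enorm_def, ENNReal.ofReal_add (by positivity) hε]
    -- The source splits as `(F(u) - F(v)) + (F(v) - G(v))`.
    refine le_trans (le_of_eq ?_) ((eLpNorm_add_le ((hm hF (u t)).sub (hm hF (v t)))
      ((hm hF (v t)).sub (hm hG (v t))) (by norm_num)).trans (add_le_add h1 h2))
    refine eLpNorm_congr_ae ?_
    filter_upwards [hda, hda', Lp.coeFn_add (d - d') (a - a'), Lp.coeFn_sub d d',
      Lp.coeFn_sub a a'] with x e1 e2 e3 e4 e5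
    simp only [Pi.add_apply, Pi.sub_apply] at *
    rw [e3, e4, e5, ← e1]
    linarith
  rw [← ofReal_norm] at hle
  exact (ENNReal.ofReal_le_ofReal_iff (by positivity)).1 hle

/-- Convergence in `H¹`, uniformly in time, as soon as the weight `p + q t` is bounded below. -/
theorem tendstoUniformlyOn_of_weight {L T p q c : ℝ} (hT : 0 < T) (hp0 : 0 ≤ p)
    (hp : p ≤ 1) (hq0 : 0 ≤ q) (hq : q ≤ 1) (hc : 0 < c) (hc1 : c ≤ 1) {S : Set ℝ}
    (hS : S ⊆ Icc 0 T) (hcS : ∀ t ∈ S, c ≤ p + q * t) {u : ℝ → H1 n} {uj : ℕ → ℝ → H1 n}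
    (hu : ContinuousOn u (Icc 0 T)) (huj : ∀ j, ContinuousOn (uj j) (Icc 0 T))
    (h : ∀ ε > 0, ∀ᶠ j in atTop, ∀ t ∈ Ioo 0 T, PerturbedHeatAt L ε (fun s => uj j s - u s) t)
    (h0 : Tendsto (fun j => (1 + (1 + T) * (L ^ 2 + 1)) * ‖toL2 (uj j 0 - u 0)‖ ^ 2
      + p * ‖grad (uj j 0 - u 0)‖ ^ 2) atTop (𝓝 0)) :
    TendstoUniformlyOn uj u atTop S := by
  rw [Metric.tendstoUniformlyOn_iff]
  intro η hη
  obtain ⟨M, hM⟩ : ∃ M, M = 1 + (1 + T) * (L ^ 2 + 1) := ⟨_, rfl⟩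
  have hM1 : 1 ≤ M := by
    have : 0 ≤ (1 + T) * (L ^ 2 + 1) := by positivity
    linarith
  rw [← hM] at h0
  have hη2 : 0 < c * η ^ 2 / 2 := by positivity
  -- The source error and the initial energy each receive half of `c η²`.
  have hsmall : ∀ᶠ ε : ℝ in 𝓝[>] 0,
      Real.exp ((L ^ 2 + 3) * T) * (2 * M * ε ^ 2 / (L ^ 2 + 3)) < c * η ^ 2 / 2 := by
    have : Continuous fun ε : ℝ => Real.exp ((L ^ 2 + 3) * T) * (2 * M * ε ^ 2 / (L ^ 2 + 3)) := by
      fun_prop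
    refine ((this.tendsto 0).mono_left nhdsWithin_le_nhds).eventually (gt_mem_nhds ?_)
    simpa using hη2
  obtain ⟨ε, hε, hε0⟩ := (hsmall.and self_mem_nhdsWithin).exists
  have hε0 : 0 < ε := hε0
  have h0' := (h0.const_mul (Real.exp ((L ^ 2 + 3) * T))).eventually_lt_const
    (u := c * η ^ 2 / 2) (by rwa [mul_zero])
  filter_upwards [h ε hε0, h0'] with j hj hj0 t ht
  have hE := energy_le (w := fun s => uj j s - u s) hT hp0 hp hq0 hq ((huj j).sub hu) hj hM (hS ht)
  have hct := hcS t ht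
  have hlow : c * ‖uj j t - u t‖ ^ 2 ≤ M * ‖toL2 (uj j t - u t)‖ ^ 2
      + (p + q * t) * ‖grad (uj j t - u t)‖ ^ 2 := by
    rw [H1.norm_sq, mul_add]
    gcongr
    linarith
  have hexp : Real.exp ((L ^ 2 + 3) * t) ≤ Real.exp ((L ^ 2 + 3) * T) := by
    gcongr
    exact (hS ht).2
  have hup := hE.trans (mul_le_mul_of_nonneg_right hexp (by positivity))
  rw [mul_add] at hup
  have hlt : c * ‖uj j t - u t‖ ^ 2 < c * η ^ 2 := by linarith
  have hlt2 := lt_of_mul_lt_mul_left hlt hc.le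
  rw [dist_comm, dist_eq_norm]
  exact lt_of_pow_lt_pow_left₀ 2 hη.le hlt2

end Main

end HeatRn
end

theorem proposition2p3 (n : ℕ) (hn : 3 ≤ n) (C R T : ℝ) (hC : 0 < C) (hT : 0 < T)
    (G : HeatRn.Rn n → ℝ → ℝ) (Gj : ℕ → HeatRn.Rn n → ℝ → ℝ)
    (hG : HeatRn.IsNonlinearity G) (hGj : ∀ j, HeatRn.IsNonlinearity (Gj j))
    (hGC : HeatRn.GrowthCondition C G) (hGjC : ∀ j, HeatRn.GrowthCondition C (Gj j))
    (hlim : ∀ (x : HeatRn.Rn n) (s : ℝ), Tendsto (fun j => Gj j x s) atTop (𝓝 (G x s)))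
    (hlim0 : Tendsto
      (fun j => eLpNorm (fun x => Gj j x 0 - G x 0) 2 (volume : Measure (HeatRn.Rn n)))
      atTop (𝓝 0))
    (u : ℝ → HeatRn.H1 n) (uj : ℕ → ℝ → HeatRn.H1 n)
    (hu : HeatRn.IsSolution G T u) (huj : ∀ j, HeatRn.IsSolution (Gj j) T (uj j))
    (huR : ∀ t ∈ Icc 0 T, ‖u t‖ ≤ R) (hujR : ∀ j, ∀ t ∈ Icc 0 T, ‖uj j t‖ ≤ R) :
    (Tendsto (fun j => HeatRn.toL2 (uj j 0)) atTop (𝓝 (HeatRn.toL2 (u 0))) →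
      ∀ δ : ℝ, 0 < δ → δ < T → TendstoUniformlyOn uj u atTop (Icc δ T)) ∧
    (Tendsto (fun j => uj j 0) atTop (𝓝 (u 0)) →
      TendstoUniformlyOn uj u atTop (Icc 0 T)) := by
  obtain ⟨L, hL1, hL⟩ := HeatRn.exists_lipschitz_nemytskii hn hC R
  have hL0 : 0 ≤ L := by linarith
  have hpert : ∀ ε > 0, ∀ᶠ j in atTop, ∀ t ∈ Ioo 0 T,
      HeatRn.PerturbedHeatAt L ε (fun s => uj j s - u s) t := by
    intro ε hε
    -- Compactness is that of the orbit `u([0,T])` in `H¹`; `G_j - G` is evaluated only along it.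
    filter_upwards [HeatRn.eventually_nemytskii_le hn hC R hG hGj hGC hGjC hlim hlim0
      (isCompact_Icc.image_of_continuousOn hu.1) (forall_mem_image.2 huR) hε] with j hj t ht
    have ht' := Ioo_subset_Icc_self ht
    exact (huj j).perturbedHeatAt_sub hu (hGj j) hG hL0 hε.le ht
      (hL _ (hGj j) (hGjC j) _ _ (hujR j t ht') (huR t ht')) (hj _ (mem_image_of_mem u ht'))
  constructor
  · intro h0 δ hδ hδT
    -- Weight `t`: it vanishes at `0`, so `L²` convergence of the data suffices, and it is at least
    -- `min δ 1` on `[δ, T]`. The `1` in the minimum keeps `c` below the coefficient `M ≥ 1` of the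
    -- `L²` term.
    refine HeatRn.tendstoUniformlyOn_of_weight (p := 0) (q := 1) (c := min δ 1) hT le_rfl
      zero_le_one zero_le_one le_rfl (lt_min hδ one_pos) (min_le_right _ _)
      (Icc_subset_Icc_left hδ.le)
      (fun t ht => by simpa using Or.inl ht.1) hu.1 (fun j => (huj j).1) hpert ?_
    have h1 := ((tendsto_iff_norm_sub_tendsto_zero.1 h0).pow 2).const_mul
      (1 + (1 + T) * (L ^ 2 + 1))
    simpa [HeatRn.toL2_sub] using h1
  · intro h0
    -- Constant weight `1`: the gradient is controlled up to `t = 0`, at the price of `H¹`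
    -- convergence of the data.
    refine HeatRn.tendstoUniformlyOn_of_weight (p := 1) (q := 0) (c := 1) hT zero_le_one
      le_rfl le_rfl zero_le_one one_pos le_rfl subset_rfl
      (fun t ht => by simp) hu.1 (fun j => (huj j).1) hpert ?_
    have h1 := tendsto_iff_norm_sub_tendsto_zero.1 h0
    have hl : Tendsto (fun j => ‖HeatRn.toL2 (uj j 0 - u 0)‖) atTop (𝓝 0) :=
      squeeze_zero (fun _ => norm_nonneg _) (fun j => HeatRn.norm_toL2_le _) h1
    have hg : Tendsto (fun j => ‖HeatRn.grad (uj j 0 - u 0)‖) atTop (𝓝 0) :=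
      squeeze_zero (fun _ => norm_nonneg _) (fun j => HeatRn.norm_grad_le _) h1
    simpa using ((hl.pow 2).const_mul (1 + (1 + T) * (L ^ 2 + 1))).add (hg.pow 2)
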